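/- \textbf{Theorem.} Let $M$ be the monoid defined by the presentation \begin{align*} \langle\, a, a^{-1}, b, b^{-1}, h, z \;|\;& aa^{-1} = a^{-1}a = bb^{-1} = b^{-1}b = 1,\\ & xh = hx,\ hxy = hyx \quad (x,y \in \{a,a^{-1},b,b^{-1}\}),\\ & h^2a = h^2a^{-1} = h^2b = h^2b^{-1} = h^3 = h^2,\ h^2 = z \,\rangle \end{align*} and let $N$ be the monoid defined by the presentation \begin{align*} \langle\, a, a^{-1}, b, b^{-1}, h, z \;|\;& aa^{-1} = a^{-1}a = bb^{-1} = b^{-1}b = 1,\\ & xh = hx,\ hxy = hyx \quad (x,y \in \{a,a^{-1},b,b^{-1}\}),\\ & zu = uz = z \quad (u \in \{a,a^{-1},b,b^{-1},h,z\}),\ h^2 = h \,\rangle . \end{align*} Let $A = \{a,a^{-1},b,b^{-1},h,z\}$, and for a monoid $S$ generated by (the images of the letters of) a finite set $A$ let $d_A$ be the directed semimetric $d_A(x,y) = \inf\{|w| : w \in A^*,\ xw = y\} \in \{0,1,2,\dots\}\cup\{\infty\}$. Then: \begin{enumerate} \item $(M,d_A)$ and $(N,d_A)$ are isometric, i.e.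 there is a bijection $f : M \to N$ with $d_A(f(x),f(y)) = d_A(x,y)$ for all $x,y \in M$; \item $M$ does not have finite derivation type (FDT) and is not presentable by a finite complete (noetherian and confluent) rewriting system; \item $N$ is presentable by a finite complete rewriting system, and $N$ has FDT. \end{enumerate} Consequently neither FDT nor presentability by a finite complete rewriting system is an isometry invariant of finitely generated monoids: neither property is determined by the isometry class of the semimetric space $(S,d_A)$ for a finite generating set $A$. Here, for a presentation $\langle A \,|\, R\rangle$, the derivation graph $\Gamma$ has vertex set $A^*$ and edges $(w_1,r,\varepsilon,w_2)$ with $w_1,w_2\in A^*$, $r=(r_{+1},r_{-1})\in R$, $\varepsilon=\pm1$, going from $w_1r_{\varepsilon}w_2$ to $w_1r_{-\varepsilon}w_2$, with inverse $(w_1,r,-\varepsilon,w_2)$; $A^*$ acts on both sides by $x\cdot(w_1,r,\varepsilon,w_2)\cdot y=(xw_1,r,\varepsilon,w_2y)$, and so on paths. Write $\iota$, $\tau$ for initial and terminal vertices. A homotopy relation is an equivalence relation $\sim$ on paths that relates only paths with the same ends and satisfies: (H1) $(e_1\cdot\iota e_2)\circ(\tau e_1\cdot e_2)\sim(\iota e_1\cdot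 e_2)\circ(e_1\cdot\tau e_2)$ for all edges $e_1,e_2$; (H2) it is invariant under the two-sided action of $A^*$; (H3) it is invariant under composition of paths on either side; (H4) $p\circ p^{-1}$ is equivalent to the empty path at $\iota p$ for every path $p$. A set $C$ of pairs of parallel paths (paths with the same ends) is a homotopy base if the smallest homotopy relation containing $C$ relates any two parallel paths. The presentation has FDT if $\Gamma$ has a finite homotopy base, and a monoid has FDT if it is defined by some finite presentation that has FDT. -/

import Mathlib

open scoped ENNReal

/-! ## Rewriting systems and finite complete presentations

A rewriting system (monoid presentation) over an alphabet `A` is a relation `rels` on the free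
monoid `A*`; `rels u v` says that `u = v` (read as `u → v`) is one of its rules.  The monoid it
defines is `PresentedMonoid rels`. -/

namespace MonoidRewriting

universe u

variable {A : Type u}

/-- The rewriting system has finitely many rules. -/
def FiniteRules (rels : FreeMonoid A → FreeMonoid A → Prop) : Prop :=
  {r : FreeMonoid A × FreeMonoid A | rels r.1 r.2}.Finite

/-- The single-step reduction relation `u →_R v`. -/
def Step (rels : FreeMonoid A → FreeMonoid A → Prop) (u v : FreeMonoid A) : Prop :=
  ∃ w₁ l r w₂ : FreeMonoid A, rels l r ∧ u = w₁ * l * w₂ ∧ v = w₁ * r * w₂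

/-- There are no infinite reduction sequences. -/
def IsNoetherian (rels : FreeMonoid A → FreeMonoid A → Prop) : Prop :=
  ¬ ∃ f : ℕ → FreeMonoid A, ∀ n, Step rels (f n) (f (n + 1))

/-- Any two descendants of a word have a common descendant. -/
def IsConfluent (rels : FreeMonoid A → FreeMonoid A → Prop) : Prop :=
  ∀ w u v : FreeMonoid A,
    Relation.ReflTransGen (Step rels) w u → Relation.ReflTransGen (Step rels) w v →
      ∃ t, Relation.ReflTransGen (Step rels) u t ∧ Relation.ReflTransGen (Step rels) v t

/-- A complete (convergent) rewriting system: noetherian and confluent. -/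
def IsComplete (rels : FreeMonoid A → FreeMonoid A → Prop) : Prop :=
  IsNoetherian rels ∧ IsConfluent rels

/-- The monoid `S` is presentable by a finite complete rewriting system. -/
def HasFiniteCompletePresentation (S : Type*) [Monoid S] : Prop :=
  ∃ (A : Type) (rels : FreeMonoid A → FreeMonoid A → Prop),
    Finite A ∧ FiniteRules rels ∧ IsComplete rels ∧ Nonempty (S ≃* PresentedMonoid rels)

/-! ## Derivation graphs, homotopy bases, finite derivation type -/

/-- An edge `(w₁, r, ε, w₂)` of the derivation graph from `u` to `v`, where `r = (r₊, r₋)` is a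
rule and `ε = ±1` (`pos = true` for `+1`).  For `ε = +1` it goes from `w₁ r₊ w₂` to `w₁ r₋ w₂`,
and for `ε = -1` in the other direction. -/
@[ext]
structure Edge (rels : FreeMonoid A → FreeMonoid A → Prop) (u v : FreeMonoid A) where
  left : FreeMonoid A
  rule : FreeMonoid A × FreeMonoid A
  pos : Bool
  right : FreeMonoid A
  rule_mem : rels rule.1 rule.2
  src_eq : left * (if pos = true then rule.1 else rule.2) * right = u
  tgt_eq : left * (if pos = true then rule.2 else rule.1) * right = v

namespace Edge

variable {rels : FreeMonoid A → FreeMonoid A → Prop} {u v : FreeMonoid A}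

/-- The inverse edge `(w₁, r, -ε, w₂)`. -/
def inv (e : Edge rels u v) : Edge rels v u where
  left := e.left
  rule := e.rule
  pos := !e.pos
  right := e.right
  rule_mem := e.rule_mem
  src_eq := by have h := e.tgt_eq
               cases hp : e.pos <;> simpa [hp] using h
  tgt_eq := by have h := e.src_eq
               cases hp : e.pos <;> simpa [hp] using h

/-- The left action `x · e = (x w₁, r, ε, w₂)`. -/
def lmul (x : FreeMonoid A) (e : Edge rels u v) : Edge rels (x * u) (x * v) where
  left := x * e.left
  rule := e.rule
  pos := e.pos
  right := e.right
  rule_mem := e.rule_mem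
  src_eq := by conv_rhs => rw [← e.src_eq]
               simp only [mul_assoc]
  tgt_eq := by conv_rhs => rw [← e.tgt_eq]
               simp only [mul_assoc]

/-- The right action `e · y = (w₁, r, ε, w₂ y)`. -/
def rmul (e : Edge rels u v) (y : FreeMonoid A) : Edge rels (u * y) (v * y) where
  left := e.left
  rule := e.rule
  pos := e.pos
  right := e.right * y
  rule_mem := e.rule_mem
  src_eq := by conv_rhs => rw [← e.src_eq]
               simp only [mul_assoc]
  tgt_eq := by conv_rhs => rw [← e.tgt_eq]
               simp only [mul_assoc]

end Edge

/-- Paths from `u` to `v` in the derivation graph, whose vertices are the words over `A` and whose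
edges are the terms of `Edge rels u v`. -/
inductive DPath (rels : FreeMonoid A → FreeMonoid A → Prop) :
    FreeMonoid A → FreeMonoid A → Type u
  | nil (u : FreeMonoid A) : DPath rels u u
  | cons {u v w : FreeMonoid A} (e : Edge rels u v) (p : DPath rels v w) : DPath rels u w

variable {rels : FreeMonoid A → FreeMonoid A → Prop}

/-- An edge, as a path of length one. -/
def Edge.path {u v : FreeMonoid A} (e : Edge rels u v) : DPath rels u v :=
  .cons e (.nil v)

namespace DPath

/-- The composition `p ∘ q` (first `p`, then `q`). -/
def comp : ∀ {u v w : FreeMonoid A}, DPath rels u v → DPath rels v w → DPath rels u w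
  | _, _, _, .nil _, q => q
  | _, _, _, .cons e p, q => .cons e (p.comp q)

/-- The inverse path. -/
def inv : ∀ {u v : FreeMonoid A}, DPath rels u v → DPath rels v u
  | _, _, .nil u => .nil u
  | _, _, .cons e p => p.inv.comp e.inv.path

/-- The two-sided action of `A*` on paths, `x · p · y`. -/
def act (x y : FreeMonoid A) :
    ∀ {u v : FreeMonoid A}, DPath rels u v → DPath rels (x * u * y) (x * v * y)
  | _, _, .nil u => .nil (x * u * y)
  | _, _, .cons e p => .cons ((e.lmul x).rmul y) (p.act x y)

end DPath

variable (rels) in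
/-- A homotopy relation: an equivalence relation `E` on the paths of the derivation graph, contained
in the relation of being parallel (`E` compares only paths with the same ends), satisfying the
conditions (H1)-(H4) below. -/
structure IsHomotopyRelation
    (E : ∀ ⦃u v : FreeMonoid A⦄, DPath rels u v → DPath rels u v → Prop) : Prop where
  equiv : ∀ u v : FreeMonoid A, Equivalence (@E u v)
  /-- (H1): applications of rules at disjoint places commute. -/
  disjoint : ∀ {u₁ v₁ u₂ v₂ : FreeMonoid A} (e₁ : Edge rels u₁ v₁) (e₂ : Edge rels u₂ v₂),
    E ((e₁.rmul u₂).path.comp (e₂.lmul v₁).path) ((e₂.lmul u₁).path.comp (e₁.rmul v₂).path)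
  /-- (H2): invariance under the two-sided action. -/
  act : ∀ {u v : FreeMonoid A} (p q : DPath rels u v) (x y : FreeMonoid A),
    E p q → E (p.act x y) (q.act x y)
  /-- (H3): invariance under composition. -/
  comp : ∀ {t u v w : FreeMonoid A} (r : DPath rels t u) (p q : DPath rels u v)
    (s : DPath rels v w), E p q → E ((r.comp p).comp s) ((r.comp q).comp s)
  /-- (H4): a path followed by its inverse is homotopic to the empty path. -/
  inv : ∀ {u v : FreeMonoid A} (p : DPath rels u v), E (p.comp p.inv) (DPath.nil u)

variable (rels) in
/-- A pair of parallel paths. -/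
structure ParallelPair where
  src : FreeMonoid A
  tgt : FreeMonoid A
  fst : DPath rels src tgt
  snd : DPath rels src tgt

/-- The homotopy relation `∼_C` generated by `C`, i.e. the smallest homotopy relation containing
`C`. -/
def HomotopyGen (C : Set (ParallelPair rels)) ⦃u v : FreeMonoid A⦄ (p q : DPath rels u v) : Prop :=
  ∀ E : ∀ ⦃u v : FreeMonoid A⦄, DPath rels u v → DPath rels u v → Prop,
    IsHomotopyRelation rels E → (∀ c ∈ C, E c.fst c.snd) → E p q

/-- `C` is a homotopy base: `∼_C` relates any two parallel paths. -/
def IsHomotopyBase (C : Set (ParallelPair rels)) : Prop :=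
  ∀ ⦃u v : FreeMonoid A⦄ (p q : DPath rels u v), HomotopyGen C p q

variable (rels) in
/-- The presentation has finite derivation type: its derivation graph has a finite homotopy base. -/
def PresentationHasFDT : Prop :=
  ∃ C : Set (ParallelPair rels), C.Finite ∧ IsHomotopyBase C

/-- The monoid `S` has finite derivation type: it is defined by some finite presentation that has
finite derivation type. -/
def HasFDT (S : Type*) [Monoid S] : Prop :=
  ∃ (A : Type) (rels : FreeMonoid A → FreeMonoid A → Prop),
    Finite A ∧ FiniteRules rels ∧ Nonempty (S ≃* PresentedMonoid rels) ∧ PresentationHasFDT rels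

/-! ## Semimetric spaces and directed Cayley semimetrics -/

/-- A semimetric on `X`: the metric axioms without symmetry, with the value `∞` allowed. -/
structure Semimetric (X : Type*) where
  dist : X → X → ℝ≥0∞
  dist_eq_zero : ∀ x y, dist x y = 0 ↔ x = y
  triangle : ∀ x y z, dist x z ≤ dist x y + dist y z

/-- Two semimetric spaces are isometric: there is a distance-preserving bijection. -/
def Isometric {X Y : Type*} (dX : Semimetric X) (dY : Semimetric Y) : Prop :=
  ∃ f : X ≃ Y, ∀ x y, dY.dist (f x) (f y) = dX.dist x y

/-- `d_A(x, y) = inf {|w| : w ∈ A*, x w = y}`, where `g` gives the element of `S` represented by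
each letter. -/
noncomputable def wordDist {A S : Type*} [Monoid S] (g : A → S) (x y : S) : ℝ≥0∞ :=
  ⨅ w : {w : FreeMonoid A // x * FreeMonoid.lift g w = y}, (w.1.length : ℝ≥0∞)

theorem wordDist_le {A S : Type*} [Monoid S] (g : A → S) (x : S) (w : FreeMonoid A) :
    wordDist g x (x * FreeMonoid.lift g w) ≤ (w.length : ℝ≥0∞) :=
  iInf_le (fun w' : {w' : FreeMonoid A // x * FreeMonoid.lift g w' = x * FreeMonoid.lift g w} =>
    (w'.1.length : ℝ≥0∞)) ⟨w, rfl⟩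

theorem wordDist_eq_zero {A S : Type*} [Monoid S] (g : A → S) (x y : S) :
    wordDist g x y = 0 ↔ x = y := by
  constructor
  · intro h
    by_contra hne
    have h1 : (1 : ℝ≥0∞) ≤ wordDist g x y := by
      refine le_iInf fun w => ?_
      have hw : w.1.length ≠ 0 := by
        intro h0
        rw [FreeMonoid.length_eq_zero] at h0
        exact hne (by rw [← w.2, h0, map_one, mul_one])
      exact_mod_cast Nat.one_le_iff_ne_zero.mpr hw
    rw [h] at h1
    exact absurd h1 (by simp)
  · rintro rfl
    have h := wordDist_le g x 1
    rw [map_one, mul_one] at h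
    simpa using h

theorem wordDist_triangle {A S : Type*} [Monoid S] (g : A → S) (x y z : S) :
    wordDist g x z ≤ wordDist g x y + wordDist g y z := by
  refine ENNReal.le_iInf_add_iInf ?_
  rintro ⟨v, rfl⟩ ⟨w, rfl⟩
  have h := wordDist_le g x (v * w)
  rw [map_mul, ← mul_assoc, FreeMonoid.length_mul] at h
  exact_mod_cast h

/-- The semimetric space `(S, d_A)` of a monoid with a family of generators. -/
noncomputable def cayleySemimetric {A S : Type*} [Monoid S] (g : A → S) : Semimetric S where
  dist := wordDist g
  dist_eq_zero := wordDist_eq_zero g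
  triangle := wordDist_triangle g

/-- A property of monoids is an isometry invariant of finitely generated monoids if it agrees on any
two finitely generated monoids whose directed Cayley semimetric spaces, for some finite generating
families, are isometric. -/
def IsIsometryInvariant (P : ∀ (S : Type) [Monoid S], Prop) : Prop :=
  ∀ (S T A B : Type) [Monoid S] [Monoid T] [Finite A] [Finite B] (g : A → S) (k : B → T),
    Submonoid.closure (Set.range g) = ⊤ → Submonoid.closure (Set.range k) = ⊤ →
      Isometric (cayleySemimetric g) (cayleySemimetric k) → (P S ↔ P T)

/-! ## The two monoids -/

/-- The six generators `a, a⁻¹, b, b⁻¹, h, z`. -/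
inductive Gen
  | a | aInv | b | bInv | h | z

namespace Gen

/-- The generators `a, a⁻¹, b, b⁻¹`. -/
def groupLetters : Set Gen := {a, aInv, b, bInv}

end Gen

open FreeMonoid Gen

/-- The relations shared by both presentations. -/
inductive CommonRel : FreeMonoid Gen → FreeMonoid Gen → Prop
  | a_aInv : CommonRel (of a * of aInv) 1
  | aInv_a : CommonRel (of aInv * of a) 1
  | b_bInv : CommonRel (of b * of bInv) 1
  | bInv_b : CommonRel (of bInv * of b) 1
  | comm_h (x : Gen) (hx : x ∈ groupLetters) : CommonRel (of x * of h) (of h * of x)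
  | h_comm (x y : Gen) (hx : x ∈ groupLetters) (hy : y ∈ groupLetters) :
      CommonRel (of h * of x * of y) (of h * of y * of x)

/-- The defining relations of `M`. -/
inductive MRel : FreeMonoid Gen → FreeMonoid Gen → Prop
  | common {u v : FreeMonoid Gen} (huv : CommonRel u v) : MRel u v
  | hsq_mul (x : Gen) (hx : x ∈ groupLetters) : MRel (of h ^ 2 * of x) (of h ^ 2)
  | h_cube : MRel (of h ^ 3) (of h ^ 2)
  | hsq_z : MRel (of h ^ 2) (of z)

/-- The defining relations of `N`. -/
inductive NRel : FreeMonoid Gen → FreeMonoid Gen → Prop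
  | common {u v : FreeMonoid Gen} (huv : CommonRel u v) : NRel u v
  | z_mul (x : Gen) : NRel (of z * of x) (of z)
  | mul_z (x : Gen) : NRel (of x * of z) (of z)
  | h_idem : NRel (of h ^ 2) (of h)

end MonoidRewriting

/-!
Let `φ` be the exponent sum homomorphism from the free group `G` on `a` and `b` to `A = ℤ²`. Both
monoids have the underlying set `G ∪ hA ∪ {0}`, where `g * hα = hα * g = h(φ(g)α)`; they differ only
in the products of two elements of the middle layer `hA`, which vanish in `M` and lie in `hA` in
`N`. The identity on this set is an isometry: the edge labelled `h` from `hα` to `0` in `M` is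
matched in `N` by the edge labelled `z`, and the edge from `hα` to itself has length zero.

`M` does not have finite derivation type. Choose a homomorphism `ρ` assigning to each word an
element of `G` that represents it, and a cocycle `D` on `G` with values in `ℤ[G]`. An application of
the rule `(l, r)` to the right of the word `w` receives the value `ρ(w)(D(ρ(l)) - D(ρ(r)))`, which
vanishes when the rule holds between elements of `G`. Because two elements of the middle layer
multiply to `0`, of two disjoint rules applied in a nonzero word one acts on an element of `G`, so
that values are invariant under the disjointness relation (H1). Let `K` be the kernel of `φ`. The
values of parallel paths agree in `ℤ[G/K]`, and for finitely many pairs they already agree in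
`ℤ[G/H]` for a finitely generated subgroup `H` of `K`. If a finite homotopy base existed, the value
in `ℤ[G/H]` of a path removing an element of `K` next to `h` would therefore be invariant under `K`,
as elements of `K` can also be removed on the other side of `h`. A nonzero invariant of `K` in
`ℤ[G/H]` forces `K` to be finitely generated. But `D` restricts to a nonzero equivariant
homomorphism from `K` to `ℤ[G/K]`, and as `G/K` is infinite, this prevents finite generation.

`N` has a finite complete presentation because the idempotent `h` splits the middle layer into
letters `c y = h y`: adjoining them, every word containing `h` is rewritten into these letters,
which commute and can be sorted. The critical pairs of a finite complete presentation form a finite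
homotopy base.
-/

namespace MonoidRewriting

section Rewriting

variable {A : Type*} {rels : FreeMonoid A → FreeMonoid A → Prop}

/-! ## Reductions and paths -/

variable (rels) in
/-- The reduction relation `u →*_R v`, the reflexive transitive closure of `Step`. -/
abbrev Reduces (u v : FreeMonoid A) : Prop := Relation.ReflTransGen (Step rels) u v

variable (rels) in
/-- The word `t` is irreducible (a normal form): no rule applies to it. -/
def IsIrreducible (t : FreeMonoid A) : Prop := ∀ v, ¬ Step rels t v

theorem Step.mul_mul {u v : FreeMonoid A} (h : Step rels u v) (x y : FreeMonoid A) :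
    Step rels (x * u * y) (x * v * y) := by
  obtain ⟨w₁, l, r, w₂, hr, rfl, rfl⟩ := h
  exact ⟨x * w₁, l, r, w₂ * y, hr, by simp only [mul_assoc], by simp only [mul_assoc]⟩

theorem Reduces.of_rel {l r : FreeMonoid A} (h : rels l r) : Reduces rels l r :=
  .single ⟨1, l, r, 1, h, by simp, by simp⟩

theorem Reduces.mul_left {u v : FreeMonoid A} (x : FreeMonoid A) (h : Reduces rels u v) :
    Reduces rels (x * u) (x * v) :=
  h.lift (x * ·) fun a b hab => by simpa using hab.mul_mul x 1

theorem Reduces.mul_right {u v : FreeMonoid A} (h : Reduces rels u v) (y : FreeMonoid A) :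
    Reduces rels (u * y) (v * y) :=
  h.lift (· * y) fun a b hab => by simpa using hab.mul_mul 1 y

theorem IsIrreducible.eq_of_reduces {t v : FreeMonoid A} (ht : IsIrreducible rels t)
    (h : Reduces rels t v) : t = v :=
  h.cases_head.resolve_right fun ⟨w, hw, _⟩ => ht w hw

theorem IsConfluent.irreducible_unique (hc : IsConfluent rels) {u t t' : FreeMonoid A}
    (ht : IsIrreducible rels t) (ht' : IsIrreducible rels t') (hu : Reduces rels u t)
    (hu' : Reduces rels u t') : t = t' := by
  obtain ⟨v, hv, hv'⟩ := hc u t t' hu hu'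
  rw [ht.eq_of_reduces hv, ht'.eq_of_reduces hv']

theorem IsNoetherian.wellFounded (h : IsNoetherian rels) :
    WellFounded fun v u => Step rels u v :=
  wellFounded_iff_isEmpty_descending_chain.2 ⟨fun f => h ⟨f.1, f.2⟩⟩

theorem IsNoetherian.exists_isIrreducible (h : IsNoetherian rels) (u : FreeMonoid A) :
    ∃ t, IsIrreducible rels t ∧ Reduces rels u t := by
  induction u using h.wellFounded.induction with
  | _ u ih =>
    by_cases hu : IsIrreducible rels u
    · exact ⟨u, hu, .refl⟩
    · obtain ⟨v, hv⟩ := not_forall_not.1 hu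
      obtain ⟨t, ht, hvt⟩ := ih v hv
      exact ⟨t, ht, .head hv hvt⟩

namespace DPath

@[simp] theorem nil_comp {u v : FreeMonoid A} (p : DPath rels u v) : (nil u).comp p = p := rfl

@[simp] theorem cons_comp {t u v w : FreeMonoid A} (e : Edge rels t u) (p : DPath rels u v)
    (q : DPath rels v w) : (cons e p).comp q = cons e (p.comp q) := rfl

@[simp] theorem comp_nil {u v : FreeMonoid A} (p : DPath rels u v) : p.comp (nil v) = p := by
  induction p with
  | nil => rfl
  | cons e p ih => rw [cons_comp, ih]

theorem comp_assoc {t u v w : FreeMonoid A} (p : DPath rels t u) (q : DPath rels u v)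
    (r : DPath rels v w) : (p.comp q).comp r = p.comp (q.comp r) := by
  induction p with
  | nil => rfl
  | cons e p ih => rw [cons_comp, cons_comp, cons_comp, ih]

/-- All edges of the path apply rules from left to right, so that the path is a reduction. -/
def IsPos : ∀ {u v : FreeMonoid A}, DPath rels u v → Prop
  | _, _, .nil _ => True
  | _, _, .cons e p => e.pos = true ∧ p.IsPos

theorem IsPos.comp {u v w : FreeMonoid A} {p : DPath rels u v} {q : DPath rels v w}
    (hp : p.IsPos) (hq : q.IsPos) : (p.comp q).IsPos := by
  induction p with
  | nil => exact hq
  | cons e p ih => exact ⟨hp.1, ih hp.2 hq⟩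

theorem IsPos.act {u v : FreeMonoid A} {p : DPath rels u v} (hp : p.IsPos) (x y : FreeMonoid A) :
    (p.act x y).IsPos := by
  induction p with
  | nil => trivial
  | cons e p ih => exact ⟨hp.1, ih hp.2⟩

end DPath

/-- The positive edge applying the rule `r` between the words `x` and `y`. -/
def ruleEdge (x : FreeMonoid A) (r : FreeMonoid A × FreeMonoid A) (y : FreeMonoid A)
    (h : rels r.1 r.2) {u : FreeMonoid A} (hu : x * r.1 * y = u) : Edge rels u (x * r.2 * y) where
  left := x
  rule := r
  pos := true
  right := y
  rule_mem := h
  src_eq := by simpa using hu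
  tgt_eq := by simp

theorem Edge.step {u v : FreeMonoid A} (e : Edge rels u v) (he : e.pos = true) : Step rels u v :=
  ⟨e.left, e.rule.1, e.rule.2, e.right, e.rule_mem, by simpa [he] using e.src_eq.symm,
    by simpa [he] using e.tgt_eq.symm⟩

theorem Step.exists_edge {u v : FreeMonoid A} (h : Step rels u v) :
    ∃ e : Edge rels u v, e.pos = true := by
  obtain ⟨l, r, r', s, hr, rfl, rfl⟩ := h
  exact ⟨ruleEdge l (r, r') s hr rfl, rfl⟩

theorem DPath.IsPos.reduces {u v : FreeMonoid A} {p : DPath rels u v} (hp : p.IsPos) :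
    Reduces rels u v := by
  induction p with
  | nil => exact .refl
  | cons e p ih => exact .head (e.step hp.1) (ih hp.2)

theorem Reduces.exists_isPos {u v : FreeMonoid A} (h : Reduces rels u v) :
    ∃ p : DPath rels u v, p.IsPos := by
  induction h using Relation.ReflTransGen.head_induction_on with
  | refl => exact ⟨.nil _, trivial⟩
  | head h _ ih =>
    obtain ⟨e, he⟩ := h.exists_edge
    obtain ⟨p, hp⟩ := ih
    exact ⟨.cons e p, he, hp⟩

theorem nonempty_dPath_of_mk_eq {u v : FreeMonoid A}
    (h : PresentedMonoid.mk rels u = PresentedMonoid.mk rels v) : Nonempty (DPath rels u v) := by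
  rw [PresentedMonoid.mk_eq_mk_iff] at h
  induction h with
  | of l r hr => exact ⟨Edge.path ⟨1, (l, r), true, 1, hr, by simp, by simp⟩⟩
  | refl w => exact ⟨.nil w⟩
  | symm _ ih => exact ih.map DPath.inv
  | trans _ _ ih ih' => exact ih.map2 DPath.comp ih'
  | @mul u₁ v₁ u₂ v₂ _ _ ih ih' =>
    obtain ⟨p⟩ := ih
    obtain ⟨q⟩ := ih'
    have p' : DPath rels (u₁ * u₂) (v₁ * u₂) := by simpa using p.act 1 u₂
    have q' : DPath rels (v₁ * u₂) (v₁ * v₂) := by simpa using q.act v₁ 1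
    exact ⟨p'.comp q'⟩

theorem Edge.mk_eq_mk {u v : FreeMonoid A} (e : Edge rels u v) :
    PresentedMonoid.mk rels u = PresentedMonoid.mk rels v := by
  obtain ⟨x, r, b, y, hr, rfl, rfl⟩ := e
  cases b <;> simp [PresentedMonoid.mk_eq_mk_of_rel hr]

theorem Reduces.mk_eq_mk {u v : FreeMonoid A} (h : Reduces rels u v) :
    PresentedMonoid.mk rels u = PresentedMonoid.mk rels v := by
  induction h with
  | refl => rfl
  | tail _ h ih =>
    obtain ⟨e, -⟩ := h.exists_edge
    exact ih.trans e.mk_eq_mk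

/-! ## Finite complete presentations have finite derivation type -/

variable {E : ∀ ⦃u v : FreeMonoid A⦄, DPath rels u v → DPath rels u v → Prop}

namespace IsHomotopyRelation

variable (hE : IsHomotopyRelation rels E)

include hE

theorem refl {u v : FreeMonoid A} (p : DPath rels u v) : E p p := (hE.equiv u v).refl p

theorem symm {u v : FreeMonoid A} {p q : DPath rels u v} (h : E p q) : E q p :=
  (hE.equiv u v).symm h

theorem trans {u v : FreeMonoid A} {p q r : DPath rels u v} (h : E p q) (h' : E q r) : E p r :=
  (hE.equiv u v).trans h h'

theorem comp_left {u v w : FreeMonoid A} (r : DPath rels u v) {p q : DPath rels v w} (h : E p q) :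
    E (r.comp p) (r.comp q) := by
  simpa using hE.comp r p q (.nil w) h

theorem cons {u v w : FreeMonoid A} (e : Edge rels u v) {p q : DPath rels v w} (h : E p q) :
    E (.cons e p) (.cons e q) := hE.comp_left e.path h

theorem comp_right {u v w : FreeMonoid A} {p q : DPath rels u v} (h : E p q) (s : DPath rels v w) :
    E (p.comp s) (q.comp s) := by
  simpa using hE.comp (.nil u) p q s h

theorem cancel_right {u v w : FreeMonoid A} {p q : DPath rels u v} (s : DPath rels v w)
    (h : E (p.comp s) (q.comp s)) : E p q := by
  have comp_comp_inv (r : DPath rels u v) : E ((r.comp s).comp s.inv) r := by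
    simpa [DPath.comp_assoc] using hE.comp_left r (hE.inv s)
  exact hE.trans (hE.symm (comp_comp_inv p))
    (hE.trans (hE.comp_right h s.inv) (comp_comp_inv q))

end IsHomotopyRelation

variable (E) in
/-- The two edges `e₁`, `e₂` with the same source can be completed by reductions to `E`-related
paths. -/
def Joins {u v₁ v₂ : FreeMonoid A} (e₁ : Edge rels u v₁) (e₂ : Edge rels u v₂) : Prop :=
  ∃ (t : FreeMonoid A) (p₁ : DPath rels v₁ t) (p₂ : DPath rels v₂ t), p₁.IsPos ∧ p₂.IsPos ∧
    E (.cons e₁ p₁) (.cons e₂ p₂)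

/-- `e = x · f · y`. This is a relation and not an equation because the two sides have different
types, although the ends of `e` are determined by `f`, `x` and `y`. -/
def Edge.IsAct {u v u' v' : FreeMonoid A} (e : Edge rels u v) (x : FreeMonoid A)
    (f : Edge rels u' v') (y : FreeMonoid A) : Prop :=
  e.left = x * f.left ∧ e.rule = f.rule ∧ e.pos = f.pos ∧ e.right = f.right * y

theorem Edge.IsAct.src_eq {u v u' v' x y : FreeMonoid A} {e : Edge rels u v} {f : Edge rels u' v'}
    (h : e.IsAct x f y) : u = x * u' * y := by
  obtain ⟨h₁, h₂, h₃, h₄⟩ := h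
  rw [← e.src_eq, ← f.src_eq, h₁, h₂, h₃, h₄]
  simp only [mul_assoc]

theorem Edge.IsAct.tgt_eq {u v u' v' x y : FreeMonoid A} {e : Edge rels u v} {f : Edge rels u' v'}
    (h : e.IsAct x f y) : v = x * v' * y := by
  obtain ⟨h₁, h₂, h₃, h₄⟩ := h
  rw [← e.tgt_eq, ← f.tgt_eq, h₁, h₂, h₃, h₄]
  simp only [mul_assoc]

namespace Joins

variable (hE : IsHomotopyRelation rels E)

include hE

theorem symm {u v₁ v₂ : FreeMonoid A} {e₁ : Edge rels u v₁} {e₂ : Edge rels u v₂}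
    (h : Joins E e₁ e₂) : Joins E e₂ e₁ := by
  obtain ⟨t, p₁, p₂, h₁, h₂, h⟩ := h
  exact ⟨t, p₂, p₁, h₂, h₁, hE.symm h⟩

theorem act {u v₁ v₂ u' v₁' v₂' x y : FreeMonoid A}
    {e₁ : Edge rels u v₁} {e₂ : Edge rels u v₂} {f₁ : Edge rels u' v₁'} {f₂ : Edge rels u' v₂'}
    (h : Joins E f₁ f₂) (h₁ : e₁.IsAct x f₁ y) (h₂ : e₂.IsAct x f₂ y) : Joins E e₁ e₂ := by
  obtain rfl := h₁.src_eq
  obtain rfl := h₁.tgt_eq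
  obtain rfl := h₂.tgt_eq
  obtain rfl : e₁ = (f₁.lmul x).rmul y := Edge.ext h₁.1 h₁.2.1 h₁.2.2.1 h₁.2.2.2
  obtain rfl : e₂ = (f₂.lmul x).rmul y := Edge.ext h₂.1 h₂.2.1 h₂.2.2.1 h₂.2.2.2
  obtain ⟨t, p₁, p₂, hp₁, hp₂, h⟩ := h
  exact ⟨x * t * y, p₁.act x y, p₂.act x y, hp₁.act x y, hp₂.act x y, hE.act _ _ x y h⟩

theorem of_disjoint {u₁ v₁ u₂ v₂ u w₁ w₂ : FreeMonoid A} {e₁ : Edge rels u w₁}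
    {e₂ : Edge rels u w₂} {f₁ : Edge rels u₁ v₁} {f₂ : Edge rels u₂ v₂} (hf₁ : f₁.pos = true)
    (hf₂ : f₂.pos = true) (h₁ : e₁.IsAct 1 f₁ u₂) (h₂ : e₂.IsAct u₁ f₂ 1) : Joins E e₁ e₂ := by
  obtain rfl : u = u₁ * u₂ := by simpa using h₁.src_eq
  obtain rfl : w₁ = v₁ * u₂ := by simpa using h₁.tgt_eq
  obtain rfl : w₂ = u₁ * v₂ := by simpa using h₂.tgt_eq
  obtain rfl : e₁ = f₁.rmul u₂ :=
    Edge.ext (by simpa [Edge.rmul] using h₁.1) h₁.2.1 h₁.2.2.1 h₁.2.2.2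
  obtain rfl : e₂ = f₂.lmul u₁ :=
    Edge.ext h₂.1 h₂.2.1 h₂.2.2.1 (by simpa [Edge.lmul] using h₂.2.2.2)
  exact ⟨v₁ * v₂, (f₂.lmul v₁).path, (f₁.rmul v₂).path, ⟨hf₂, trivial⟩, ⟨hf₁, trivial⟩,
    hE.disjoint f₁ f₂⟩

end Joins

theorem mul_eq_mul_cases {x y z w : FreeMonoid A} (h : x * y = z * w) :
    (∃ m, z = x * m ∧ y = m * w) ∨ ∃ m, x = z * m ∧ w = m * y :=
  List.append_eq_append_iff.1 h

section ShortPeaks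

variable (hE : IsHomotopyRelation rels E) {K : ℕ} (hK : ∀ l r, rels l r → l.length ≤ K)
  (short : ∀ ⦃u v₁ v₂ : FreeMonoid A⦄ (e₁ : Edge rels u v₁) (e₂ : Edge rels u v₂),
    e₁.pos = true → e₂.pos = true → u.length ≤ K + K → Joins E e₁ e₂)

include hE hK short

theorem joins_of_short_of_left_eq {u v₁ v₂ : FreeMonoid A} (e₁ : Edge rels u v₁)
    (e₂ : Edge rels u v₂) (h₁ : e₁.pos = true) (h₂ : e₂.pos = true) (m : FreeMonoid A)
    (hleft : e₂.left = e₁.left * m)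
    (hright : e₁.rule.1 * e₁.right = m * (e₂.rule.1 * e₂.right)) : Joins E e₁ e₂ := by
  have hK₁ := hK _ _ e₁.rule_mem
  have hK₂ := hK _ _ e₂.rule_mem
  -- The two left-hand sides are disjoint, or the second is inside the first, or they overlap.
  rcases mul_eq_mul_cases hright with ⟨k, hk, hs⟩ | ⟨k, hk, hs⟩
  · refine Joins.of_disjoint hE (f₁ := ruleEdge e₁.left e₁.rule 1 e₁.rule_mem rfl)
      (f₂ := ruleEdge k e₂.rule e₂.right e₂.rule_mem rfl) rfl rfl
      ⟨?_, rfl, h₁, ?_⟩ ⟨?_, rfl, h₂, ?_⟩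
      <;> simp [ruleEdge, hs, hleft, hk, mul_assoc]
  rcases mul_eq_mul_cases hs with ⟨j, hj, ht⟩ | ⟨j, hj, ht⟩
  · refine (short (ruleEdge 1 e₁.rule 1 e₁.rule_mem (by simp))
      (ruleEdge m e₂.rule j e₂.rule_mem (u := e₁.rule.1) (by rw [hk, hj, mul_assoc]))
      rfl rfl (by omega)).act hE (x := e₁.left) (y := e₁.right)
      ⟨?_, rfl, h₁, ?_⟩ ⟨hleft, rfl, h₂, ht⟩ <;> simp [ruleEdge]
  · have hj_length : j.length ≤ K := by
      rw [hj, FreeMonoid.length_mul] at hK₂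
      omega
    refine (short (ruleEdge 1 e₁.rule j e₁.rule_mem (by simp))
      (ruleEdge m e₂.rule 1 e₂.rule_mem (u := e₁.rule.1 * j) (by simp [hk, hj, mul_assoc]))
      rfl rfl (by rw [FreeMonoid.length_mul]; omega)).act hE (x := e₁.left) (y := e₂.right)
      ⟨?_, rfl, h₁, ht⟩ ⟨hleft, rfl, h₂, ?_⟩ <;> simp [ruleEdge]

theorem joins_of_short {u v₁ v₂ : FreeMonoid A} (e₁ : Edge rels u v₁) (e₂ : Edge rels u v₂)
    (h₁ : e₁.pos = true) (h₂ : e₂.pos = true) : Joins E e₁ e₂ := by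
  have src : e₁.left * (e₁.rule.1 * e₁.right) = e₂.left * (e₂.rule.1 * e₂.right) := by
    rw [← mul_assoc, ← mul_assoc]
    simpa [h₁, h₂] using e₁.src_eq.trans e₂.src_eq.symm
  rcases mul_eq_mul_cases src with ⟨m, hm, hm'⟩ | ⟨m, hm, hm'⟩
  · exact joins_of_short_of_left_eq hE hK short e₁ e₂ h₁ h₂ m hm hm'
  · exact (joins_of_short_of_left_eq hE hK short e₂ e₁ h₂ h₁ m hm hm').symm hE

end ShortPeaks

section Peaks

variable (hE : IsHomotopyRelation rels E) (hc : IsComplete rels)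
  (peaks : ∀ ⦃u v₁ v₂ : FreeMonoid A⦄ (e₁ : Edge rels u v₁) (e₂ : Edge rels u v₂),
    e₁.pos = true → e₂.pos = true → Joins E e₁ e₂)

include hE hc peaks

theorem homotopic_of_isPos {u t : FreeMonoid A} (ht : IsIrreducible rels t)
    {p q : DPath rels u t} (hp : p.IsPos) (hq : q.IsPos) : E p q := by
  induction u using hc.1.wellFounded.induction with
  | _ u ih =>
    cases p with
    | nil =>
      cases q with
      | nil => exact hE.refl _
      | cons e q => exact absurd (e.step hq.1) (ht _)
    | cons e₁ p =>
      cases q with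
      | nil => exact absurd (e₁.step hp.1) (ht _)
      | cons e₂ q =>
        obtain ⟨s, p₁, p₂, h₁, h₂, h⟩ := peaks e₁ e₂ hp.1 hq.1
        obtain ⟨t', ht', hs⟩ := hc.1.exists_isIrreducible s
        obtain ⟨r, hr⟩ := hs.exists_isPos
        obtain rfl : t = t' := hc.2.irreducible_unique ht ht' hp.2.reduces (h₁.comp hr).reduces
        have a₁ := hE.cons e₁ (ih _ (e₁.step hp.1) hp.2 (h₁.comp hr))
        have a₂ := hE.cons e₂ (ih _ (e₂.step hq.1) hq.2 (h₂.comp hr))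
        exact hE.trans a₁ (hE.trans (hE.comp_right h r) (hE.symm a₂))

theorem exists_isPos_homotopic_comp {u v t : FreeMonoid A} (ht : IsIrreducible rels t)
    (p : DPath rels u v) {b : DPath rels v t} (hb : b.IsPos) :
    ∃ a : DPath rels u t, a.IsPos ∧ E (p.comp b) a := by
  induction p with
  | nil => exact ⟨b, hb, hE.refl b⟩
  | @cons u w v e p ih =>
    obtain ⟨c, hc', hpc⟩ := ih hb
    cases he : e.pos with
    | true => exact ⟨.cons e c, ⟨he, hc'⟩, hE.cons e hpc⟩
    | false =>
      have he' : e.inv.pos = true := by simp [Edge.inv, he]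
      obtain ⟨t', ht', hu⟩ := hc.1.exists_isIrreducible u
      obtain rfl : t' = t :=
        hc.2.irreducible_unique ht' ht (.head (e.inv.step he') hu) hc'.reduces
      obtain ⟨a, ha⟩ := hu.exists_isPos
      have hca : E c (.cons e.inv a) := homotopic_of_isPos hE hc peaks ht hc' ⟨he', ha⟩
      exact ⟨a, ha, hE.trans (hE.cons e (hE.trans hpc hca)) (hE.comp_right (hE.inv e.path) a)⟩

theorem homotopic_of_parallel {u v : FreeMonoid A} (p q : DPath rels u v) : E p q := by
  obtain ⟨t, ht, hv⟩ := hc.1.exists_isIrreducible v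
  obtain ⟨b, hb⟩ := hv.exists_isPos
  obtain ⟨a, ha, hpa⟩ := exists_isPos_homotopic_comp hE hc peaks ht p hb
  obtain ⟨a', ha', hqa'⟩ := exists_isPos_homotopic_comp hE hc peaks ht q hb
  have haa' := homotopic_of_isPos hE hc peaks ht ha ha'
  exact hE.cancel_right b (hE.trans hpa (hE.trans haa' (hE.symm hqa')))

end Peaks

theorem finite_sigma_edge [Finite A] (hfin : FiniteRules rels) (u : FreeMonoid A) :
    Finite (Σ v, Edge rels u v) := by
  let W := {w : FreeMonoid A // w.length ≤ u.length}
  let R := {r : FreeMonoid A × FreeMonoid A // rels r.1 r.2}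
  have : Finite W := List.finite_length_le A u.length
  have : Finite R := hfin
  have length_le {v : FreeMonoid A} (e : Edge rels u v) :
      e.left.length ≤ u.length ∧ e.right.length ≤ u.length := by
    have h := congrArg FreeMonoid.length e.src_eq
    simp only [FreeMonoid.length_mul] at h
    omega
  refine Finite.of_injective (β := W × R × Bool × W) (fun e => (⟨e.2.left, (length_le e.2).1⟩,
    ⟨e.2.rule, e.2.rule_mem⟩, e.2.pos, ⟨e.2.right, (length_le e.2).2⟩)) ?_
  rintro ⟨v, x, r, b, y, hr, hu, rfl⟩ ⟨v', x', r', b', y', hr', hu', rfl⟩ h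
  simp only [W, R, Prod.mk.injEq, Subtype.mk.injEq] at h
  obtain ⟨rfl, rfl, rfl, rfl⟩ := h
  rfl

theorem IsConfluent.exists_isPos (hc : IsConfluent rels) {u v₁ v₂ : FreeMonoid A}
    (e₁ : Edge rels u v₁) (e₂ : Edge rels u v₂) (h₁ : e₁.pos = true) (h₂ : e₂.pos = true) :
    ∃ (t : FreeMonoid A) (p₁ : DPath rels v₁ t) (p₂ : DPath rels v₂ t), p₁.IsPos ∧ p₂.IsPos := by
  obtain ⟨t, ht₁, ht₂⟩ := hc u v₁ v₂ (.single (e₁.step h₁)) (.single (e₂.step h₂))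
  obtain ⟨p₁, hp₁⟩ := Reduces.exists_isPos ht₁
  obtain ⟨p₂, hp₂⟩ := Reduces.exists_isPos ht₂
  exact ⟨t, p₁, p₂, hp₁, hp₂⟩

theorem presentationHasFDT_of_isComplete [Finite A] (hfin : FiniteRules rels)
    (hc : IsComplete rels) : PresentationHasFDT rels := by
  obtain ⟨K, hK⟩ : ∃ K : ℕ, ∀ l r, rels l r → l.length ≤ K := by
    obtain ⟨K, hK⟩ := (hfin.image fun r => r.1.length).bddAbove
    exact ⟨K, fun l r h => hK ⟨(l, r), h, rfl⟩⟩
  let W := {w : FreeMonoid A // w.length ≤ K + K}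
  let PosEdge (u : FreeMonoid A) := {e : Σ v, Edge rels u v // e.2.pos = true}
  have : Finite W := List.finite_length_le A (K + K)
  have (u : FreeMonoid A) : Finite (Σ v, Edge rels u v) := finite_sigma_edge hfin u
  choose t p₁ p₂ hp₁ hp₂ using fun x : Σ u : W, PosEdge u × PosEdge u =>
    hc.2.exists_isPos x.2.1.1.2 x.2.2.1.2 x.2.1.2 x.2.2.2
  let resolution (x : Σ u : W, PosEdge u × PosEdge u) : ParallelPair rels :=
    ⟨_, _, .cons x.2.1.1.2 (p₁ x), .cons x.2.2.1.2 (p₂ x)⟩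
  refine ⟨Set.range resolution, Set.finite_range resolution, fun u v p q E hE hC => ?_⟩
  refine homotopic_of_parallel hE hc (fun _ _ _ => joins_of_short hE hK ?_) p q
  intro u v₁ v₂ e₁ e₂ h₁ h₂ hu
  let x : Σ u : W, PosEdge u × PosEdge u := ⟨⟨u, hu⟩, ⟨⟨v₁, e₁⟩, h₁⟩, ⟨⟨v₂, e₂⟩, h₂⟩⟩
  exact ⟨t x, p₁ x, p₂ x, hp₁ x, hp₂ x, hC (resolution x) ⟨x, rfl⟩⟩

theorem HasFiniteCompletePresentation.hasFDT {S : Type*} [Monoid S]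
    (h : HasFiniteCompletePresentation S) : HasFDT S := by
  obtain ⟨A, rels, hA, hfin, hc, e⟩ := h
  exact ⟨A, rels, hA, hfin, e, presentationHasFDT_of_isComplete hfin hc⟩

end Rewriting

section LayeredMonoid

/-! ## Layered monoids -/

variable {G A : Type*} [Monoid G] [Monoid A]

/-- The underlying set `G ∪ hA ∪ {0}` of the monoid obtained from `G` by adjoining a zero and a
central element `h` such that `h * g` depends only on `φ g`, and `h * h` is `h` or `0` according to
`idem`. Here `base g` stands for `g` and `mid α` for `h * α`. -/
inductive Layered (φ : G →* A) (idem : Bool) : Type _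
  | base (g : G)
  | mid (α : A)
  | zero

namespace Layered

variable {φ : G →* A} {idem : Bool}

instance : Mul (Layered φ idem) where
  mul
    | base g, base g' => base (g * g')
    | base g, mid β => mid (φ g * β)
    | mid α, base g => mid (α * φ g)
    | mid α, mid β => if idem then mid (α * β) else zero
    | _, _ => zero

instance : One (Layered φ idem) := ⟨base 1⟩

theorem one_def : (1 : Layered φ idem) = base 1 := rfl

@[simp] theorem base_mul_base (g g' : G) : (base g * base g' : Layered φ idem) = base (g * g') :=
  rfl

@[simp] theorem base_mul_mid (g : G) (β : A) : (base g * mid β : Layered φ idem) = mid (φ g * β) :=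
  rfl

@[simp] theorem mid_mul_base (α : A) (g : G) : (mid α * base g : Layered φ idem) = mid (α * φ g) :=
  rfl

@[simp] theorem mid_mul_mid (α β : A) :
    (mid α * mid β : Layered φ idem) = if idem then mid (α * β) else zero := rfl

@[simp] theorem zero_mul (x : Layered φ idem) : zero * x = zero := by cases x <;> rfl

@[simp] theorem mul_zero (x : Layered φ idem) : x * zero = zero := by cases x <;> rfl

instance : Monoid (Layered φ idem) where
  one_mul x := by cases x <;> simp [one_def]
  mul_one x := by cases x <;> simp [one_def]
  mul_assoc x y z := by
    cases idem <;> rcases x with x | x | _ <;> rcases y with y | y | _ <;>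
      rcases z with z | z | _ <;> simp [mul_assoc]

variable (φ idem) in
/-- The inclusion of `G` into the layered monoid. -/
@[simps]
def baseHom : G →* Layered φ idem where
  toFun := base
  map_one' := rfl
  map_mul' _ _ := rfl

theorem mem_of_mrange_baseHom_le {S : Submonoid (Layered φ idem)} (hφ : Function.Surjective φ)
    (base_mem : MonoidHom.mrange (baseHom φ idem) ≤ S) (mid_one_mem : mid 1 ∈ S)
    (zero_mem : zero ∈ S) (x : Layered φ idem) : x ∈ S := by
  rcases x with g | α | _
  · exact base_mem ⟨g, rfl⟩
  · obtain ⟨g, rfl⟩ := hφ α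
    simpa using S.mul_mem mid_one_mem (base_mem ⟨g, rfl⟩)
  · exact zero_mem

section lift

variable {P : Type*} [Monoid P] (hφ : Function.Surjective φ) (f : G →* P) (h z : P)
  (comm : ∀ g, f g * h = h * f g) (glue : ∀ g g', φ g = φ g' → h * f g = h * f g')
  (sq : h * h = if idem then h else z) (z_mul : ∀ p, z * p = z) (mul_z : ∀ p, p * z = z)

/-- The homomorphism out of a layered monoid given by the images of `G`, of `h` and of the zero. -/
noncomputable def lift : Layered φ idem →* P :=
  let F : Layered φ idem → P
    | base g => f g
    | mid α => h * f (Function.surjInv hφ α)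
    | zero => z
  have F_mid (g : G) : F (mid (φ g)) = h * f g := glue _ _ (Function.surjInv_eq hφ _)
  have base_mid (g g' : G) : F (base g * mid (φ g')) = f g * (h * f g') := by
    rw [base_mul_mid, ← map_mul, F_mid, map_mul, ← mul_assoc, ← mul_assoc, comm]
  have mid_base (g g' : G) : F (mid (φ g) * base g') = h * f g * f g' := by
    rw [mid_mul_base, ← map_mul, F_mid, map_mul, mul_assoc]
  have mid_mid (g g' : G) : F (mid (φ g) * mid (φ g')) = h * f g * (h * f g') := by
    have move_h : h * f g * (h * f g') = h * h * f (g * g') := by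
      rw [map_mul, mul_assoc, ← mul_assoc (f g), comm, mul_assoc, mul_assoc]
    rw [move_h, sq, mid_mul_mid, ← map_mul]
    cases idem
    · exact (z_mul _).symm
    · exact F_mid _
  { toFun := F
    map_one' := map_one f
    map_mul' := by
      rintro (g | α | _) (g' | β | _)
      · exact map_mul f g g'
      · obtain ⟨g', rfl⟩ := hφ β
        rw [F_mid, base_mid]
      · exact (mul_z _).symm
      · obtain ⟨g, rfl⟩ := hφ α
        rw [F_mid, mid_base]
      · obtain ⟨g, rfl⟩ := hφ α
        obtain ⟨g', rfl⟩ := hφ β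
        rw [F_mid, F_mid, mid_mid]
      · exact (mul_z _).symm
      all_goals exact (z_mul _).symm }

@[simp] theorem lift_base (g : G) :
    lift hφ f h z comm glue sq z_mul mul_z (base g) = f g := rfl

@[simp] theorem lift_mid_one : lift hφ f h z comm glue sq z_mul mul_z (mid 1) = h :=
  (glue _ 1 (by rw [Function.surjInv_eq hφ, map_one])).trans (by rw [map_one, mul_one])

@[simp] theorem lift_zero : lift hφ f h z comm glue sq z_mul mul_z zero = z := rfl

end lift

end Layered

end LayeredMonoid

section Cocycles

open groupCohomology

open scoped commutatorElement

attribute [local instance] Finsupp.comapDistribMulAction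

/-! ## Finite generation of normal subgroups and permutation modules -/

section Cosets

variable {G : Type*} [Group G]

/-- The homomorphism `ℤ[G] → ℤ[G/H]` of left `G`-modules, group rings being encoded as finitely
supported functions on which `G` acts by `Finsupp.comapDistribMulAction`. -/
noncomputable def toCosets (H : Subgroup G) : (G →₀ ℤ) →+[G] (G ⧸ H →₀ ℤ) where
  __ := Finsupp.mapDomain.addMonoidHom (QuotientGroup.mk : G → G ⧸ H)
  map_smul' g F := by
    change Finsupp.mapDomain _ (Finsupp.mapDomain _ F) =
      Finsupp.mapDomain _ (Finsupp.mapDomain _ F)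
    rw [← Finsupp.mapDomain_comp, ← Finsupp.mapDomain_comp]
    rfl

theorem toCosets_apply (H : Subgroup G) (F : G →₀ ℤ) :
    toCosets H F = Finsupp.mapDomain QuotientGroup.mk F := rfl

theorem toCosets_eq_zero_of_le {H K : Subgroup G} (hHK : H ≤ K) {F : G →₀ ℤ}
    (hF : toCosets H F = 0) : toCosets K F = 0 := by
  have factor : (QuotientGroup.mk : G → G ⧸ K) = Subgroup.quotientMapOfLE hHK ∘ QuotientGroup.mk :=
    rfl
  rw [toCosets_apply, factor, Finsupp.mapDomain_comp, ← toCosets_apply, hF, Finsupp.mapDomain_zero]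

theorem exists_fg_toCosets_eq_zero (K : Subgroup G) {𝓕 : Set (G →₀ ℤ)} (h𝓕 : 𝓕.Finite)
    (hK : ∀ F ∈ 𝓕, toCosets K F = 0) :
    ∃ H ≤ K, H.FG ∧ ∀ F ∈ 𝓕, toCosets H F = 0 := by
  let rep (g : G) : G := (g : G ⧸ K).out
  let T : Set G := ⋃ F ∈ 𝓕, (fun g => (rep g)⁻¹ * g) '' F.support
  have hT : T.Finite := h𝓕.biUnion fun F _ => F.support.finite_toSet.image _
  refine ⟨Subgroup.closure T, ?_, ⟨hT.toFinset, by simp⟩, fun F hF => ?_⟩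
  · rw [Subgroup.closure_le]
    simp only [T, Set.iUnion_subset_iff, Set.image_subset_iff]
    exact fun F _ g _ => QuotientGroup.eq.1 (QuotientGroup.out_eq' _)
  · have mk_rep : ∀ g ∈ F.support, (g : G ⧸ Subgroup.closure T) = rep g := fun g hg =>
      (QuotientGroup.eq.2 (Subgroup.subset_closure
        (Set.mem_biUnion hF (Set.mem_image_of_mem _ hg)))).symm
    have factor : (fun g => (rep g : G ⧸ Subgroup.closure T)) =
        (fun q : G ⧸ K => (q.out : G ⧸ Subgroup.closure T)) ∘ QuotientGroup.mk := rfl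
    rw [toCosets_apply, Finsupp.mapDomain_congr mk_rep, factor, Finsupp.mapDomain_comp,
      ← toCosets_apply, hK F hF, Finsupp.mapDomain_zero]

theorem fg_of_finite_cosets {H K : Subgroup G} (hHK : H ≤ K) (hH : H.FG)
    (hfin : (QuotientGroup.mk '' (K : Set G) : Set (G ⧸ H)).Finite) : K.FG := by
  obtain ⟨R, hRK, hR, hmk⟩ := hfin.exists_subset_finite_image_eq subset_rfl
  have sup_eq : H ⊔ Subgroup.closure R = K := by
    refine le_antisymm (sup_le hHK ((Subgroup.closure_le K).2 hRK)) fun k hk => ?_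
    obtain ⟨r, hr, hrk⟩ : (k : G ⧸ H) ∈ QuotientGroup.mk '' R := hmk ▸ Set.mem_image_of_mem _ hk
    rw [sup_comm]
    simpa using Subgroup.mul_mem_sup (Subgroup.subset_closure hr) (QuotientGroup.eq.1 hrk)
  exact sup_eq ▸ hH.sup ⟨hR.toFinset, by simp⟩

/-- The coset space `K/H` embeds into the support of `x`. -/
theorem fg_of_forall_smul_eq {H K : Subgroup G} [K.Normal] (hHK : H ≤ K) (hH : H.FG)
    {x : G ⧸ H →₀ ℤ} (hx : x ≠ 0) (hinv : ∀ k ∈ K, k • x = x) : K.FG := by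
  obtain ⟨q, hq⟩ := Finsupp.ne_iff.1 hx
  obtain ⟨g, rfl⟩ := QuotientGroup.mk_surjective q
  refine fg_of_finite_cosets hHK hH
    (.of_finite_image (f := (g • ·)) (x.support.finite_toSet.subset ?_)
      (MulAction.injective g).injOn)
  rintro _ ⟨_, ⟨k, hk, rfl⟩, rfl⟩
  have conj_mem : g * k * g⁻¹ ∈ K := ‹K.Normal›.conj_mem k hk g
  rw [Finset.mem_coe, Finsupp.mem_support_iff, ← hinv _ conj_mem, Finsupp.comapSMul_apply]
  simpa [mul_assoc] using hq

section

variable {K : Subgroup G} [K.Normal] {D : G → G ⧸ K →₀ ℤ}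

theorem smul_eq_self_of_mem {k : G} (hk : k ∈ K) (x : G ⧸ K →₀ ℤ) : k • x = x := by
  ext q
  obtain ⟨g, rfl⟩ := QuotientGroup.mk_surjective q
  rw [Finsupp.comapSMul_apply]
  congr 1
  refine QuotientGroup.eq.2 ?_
  simpa using ‹K.Normal›.conj_mem' k hk g

theorem mul_smul_eq_of_mem {k : G} (hk : k ∈ K) (g : G) (x : G ⧸ K →₀ ℤ) :
    (g * k) • x = g • x := by rw [mul_smul, smul_eq_self_of_mem hk]

/-- On `K` the cocycle is an equivariant homomorphism, so the translates of its value at `k` would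
all be supported in the finitely many cosets on which the values at generators of `K` live. -/
theorem not_fg_of_isCocycle₁ [Infinite (G ⧸ K)]
    (hD : IsCocycle₁ D) {k : G} (hk : k ∈ K) (hDk : D k ≠ 0) : ¬ K.FG := by
  classical
  rintro ⟨S, hS⟩
  let T : Finset (G ⧸ K) := S.biUnion fun s => (D s).support
  have support_subset {k' : G} (hk' : k' ∈ K) : (D k').support ⊆ T := by
    subst hS
    induction hk' using Subgroup.closure_induction with
    | mem s hs => exact Finset.subset_biUnion_of_mem (fun s => (D s).support) hs
    | one => simp [map_one_of_isCocycle₁ hD]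
    | mul x y hx _ ihx ihy =>
      rw [hD, smul_eq_self_of_mem hx]
      exact Finsupp.support_add.trans (Finset.union_subset ihy ihx)
    | inv x hx ih =>
      rw [← smul_eq_self_of_mem hx (D x⁻¹), map_inv_of_isCocycle₁ hD, Finsupp.support_neg]
      exact ih
  have conj (g : G) : D (g * k * g⁻¹) = g • D k := by
    rw [hD, hD, mul_smul_eq_of_mem hk, map_inv_of_isCocycle₁ hD]
    abel
  obtain ⟨q, hq⟩ := Finsupp.ne_iff.1 hDk
  refine Set.infinite_univ (α := G ⧸ K) (T.finite_toSet.subset fun q' _ => ?_)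
  obtain ⟨g, rfl⟩ := MulAction.exists_smul_eq G q q'
  refine support_subset (‹K.Normal›.conj_mem k hk g) ?_
  rw [conj, Finsupp.mem_support_iff, Finsupp.comapSMul_apply, inv_smul_smul]
  exact hq

end

end Cosets

/-! ## Values of paths -/

section Value

variable {L : Type*} {rels : FreeMonoid L → FreeMonoid L → Prop} {G : Type*} [Group G]
  {V : Type*} [AddCommGroup V] [DistribMulAction G V]

/-- The value in `V` of an edge of the derivation graph: if `D` is a cocycle, it is what remains of
the change of `D ∘ ρ` along the edge once `G` acts through a quotient in which the two sides of the
rule agree. -/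
def Edge.value (D : G → V) (ρ : FreeMonoid L →* G) {u v : FreeMonoid L} (e : Edge rels u v) : V :=
  ρ e.left • (D (ρ (if e.pos = true then e.rule.1 else e.rule.2)) -
    D (ρ (if e.pos = true then e.rule.2 else e.rule.1)))

/-- The value in `V` of a path, the sum of the values of its edges. -/
def DPath.value (D : G → V) (ρ : FreeMonoid L →* G) : ∀ {u v : FreeMonoid L}, DPath rels u v → V
  | _, _, .nil _ => 0
  | _, _, .cons e p => e.value D ρ + p.value D ρ

variable (D : G → V) (ρ : FreeMonoid L →* G)

theorem Edge.value_inv {u v : FreeMonoid L} (e : Edge rels u v) :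
    e.inv.value D ρ = -e.value D ρ := by
  cases he : e.pos <;> simp [Edge.value, Edge.inv, he, ← smul_neg]

theorem Edge.value_lmul {u v : FreeMonoid L} (x : FreeMonoid L) (e : Edge rels u v) :
    (e.lmul x).value D ρ = ρ x • e.value D ρ :=
  (congrArg (· • _) (map_mul ρ x e.left)).trans (mul_smul _ _ _)

theorem Edge.value_rmul {u v : FreeMonoid L} (e : Edge rels u v) (y : FreeMonoid L) :
    (e.rmul y).value D ρ = e.value D ρ := rfl

theorem Edge.value_map {W : Type*} [AddCommGroup W] [DistribMulAction G W] (f : V →+[G] W)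
    {u v : FreeMonoid L} (e : Edge rels u v) : e.value (f ∘ D) ρ = f (e.value D ρ) := by
  simp only [Edge.value, Function.comp_apply, map_smul, map_sub]

namespace DPath

@[simp] theorem value_path {u v : FreeMonoid L} (e : Edge rels u v) :
    e.path.value D ρ = e.value D ρ := add_zero _

@[simp] theorem value_comp {u v w : FreeMonoid L} (p : DPath rels u v) (q : DPath rels v w) :
    (p.comp q).value D ρ = p.value D ρ + q.value D ρ := by
  induction p with
  | nil => exact (zero_add _).symm
  | cons e p ih => simp only [cons_comp, value, ih, add_assoc]

@[simp] theorem value_inv {u v : FreeMonoid L} (p : DPath rels u v) :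
    p.inv.value D ρ = -p.value D ρ := by
  induction p with
  | nil => exact neg_zero.symm
  | cons e p ih =>
    simp only [DPath.inv, value_comp, value_path, Edge.value_inv, value, ih, neg_add_rev]

@[simp] theorem value_act {u v : FreeMonoid L} (p : DPath rels u v) (x y : FreeMonoid L) :
    (p.act x y).value D ρ = ρ x • p.value D ρ := by
  induction p with
  | nil => exact (smul_zero _).symm
  | cons e p ih =>
    simp only [DPath.act, value, Edge.value_rmul, Edge.value_lmul, ih, smul_add]

theorem value_map {W : Type*} [AddCommGroup W] [DistribMulAction G W] (f : V →+[G] W)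
    {u v : FreeMonoid L} (p : DPath rels u v) : p.value (f ∘ D) ρ = f (p.value D ρ) := by
  induction p with
  | nil => exact (map_zero f).symm
  | cons e p ih => simp only [value, Edge.value_map, ih, map_add]

theorem mk_eq_mk {u v : FreeMonoid L} (p : DPath rels u v) :
    PresentedMonoid.mk rels u = PresentedMonoid.mk rels v := by
  induction p with
  | nil => rfl
  | cons e _ ih => exact e.mk_eq_mk.trans ih

end DPath

end Value

namespace Layered

section Represents

variable {G A : Type*} [Monoid G] [Monoid A] {φ : G →* A} {idem : Bool}

/-- `g` represents the element `x` of a layered monoid: it is `x` itself if `x` lies in `G`, and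
`x = h * g` if `x` lies in the middle layer. -/
def Represents (g : G) : Layered φ idem → Prop
  | base g' => g = g'
  | mid α => φ g = α
  | zero => True

theorem Represents.mul {g g' : G} {x y : Layered φ idem} (hg : Represents g x)
    (hg' : Represents g' y) : Represents (g * g') (x * y) := by
  rcases x with x | x | _ <;> rcases y with y | y | _ <;> cases idem <;>
    simp_all [Represents]

theorem exists_represents (hφ : Function.Surjective φ) (x : Layered φ idem) :
    ∃ g, Represents g x := by
  rcases x with g | α | _
  · exact ⟨g, rfl⟩
  · exact hφ α
  · exact ⟨1, trivial⟩

theorem Represents.map_eq {g g' : G} {x : Layered φ idem} (hx : x ≠ zero) (hg : Represents g x)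
    (hg' : Represents g' x) : φ g = φ g' := by
  rcases x with y | α | _
  · rw [show g = y from hg, show g' = y from hg']
  · exact Eq.trans hg (Eq.symm hg')
  · exact absurd rfl hx

theorem exists_monoidHom_represents (hφ : Function.Surjective φ) {L : Type*}
    (ev : FreeMonoid L →* Layered φ idem) :
    ∃ ρ : FreeMonoid L →* G, ∀ w, Represents (ρ w) (ev w) := by
  choose rep hrep using exists_represents (φ := φ) (idem := idem) hφ
  refine ⟨FreeMonoid.lift fun x => rep (ev (.of x)), fun w => ?_⟩
  induction w using FreeMonoid.inductionOn' with
  | one => simp [Represents, one_def]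
  | of_mul x w ih => simpa using (hrep _).mul ih

theorem eq_base_of_mul_ne_zero {x y : Layered φ false} (hxy : x * y ≠ zero) :
    (∃ g, x = base g) ∨ ∃ g, y = base g := by
  rcases x with x | x | _ <;> rcases y with y | y | _ <;> simp_all

theorem eq_base_of_mul_mul_eq_base {x y z : Layered φ false} {g : G} (h : x * y * z = base g) :
    ∃ g', y = base g' := by
  rcases x with x | x | _ <;> rcases y with y | y | _ <;> rcases z with z | z | _ <;> simp_all

theorem left_ne_zero_of_mul {x y : Layered φ idem} (hxy : x * y ≠ zero) : x ≠ zero := by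
  rintro rfl; exact hxy (zero_mul y)

theorem right_ne_zero_of_mul {x y : Layered φ idem} (hxy : x * y ≠ zero) : y ≠ zero := by
  rintro rfl; exact hxy (mul_zero x)

end Represents

section Homotopy

variable {G A : Type*} [Group G] [Group A] {φ : G →* A}
  {L : Type} {rels : FreeMonoid L → FreeMonoid L → Prop}
  (ψ : PresentedMonoid rels →* Layered φ false) {ρ : FreeMonoid L →* G}
  (hρ : ∀ w, Represents (ρ w) (ψ (PresentedMonoid.mk rels w)))
  {V : Type*} [AddCommGroup V] [DistribMulAction G V] {D : G → V}

include hρ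

theorem value_eq_zero_of_eq_base {u v : FreeMonoid L} (e : Edge rels u v) {g : G}
    (hu : ψ (PresentedMonoid.mk rels u) = base g) : e.value D ρ = 0 := by
  obtain ⟨l, ⟨p, q⟩, b, s, hr, rfl, rfl⟩ := e
  have mk_eq : PresentedMonoid.mk rels p = PresentedMonoid.mk rels q :=
    PresentedMonoid.mk_eq_mk_of_rel hr
  have sides : ∃ g', ψ (PresentedMonoid.mk rels p) = base g' := by
    have hside : ψ (PresentedMonoid.mk rels (if b = true then p else q)) =
        ψ (PresentedMonoid.mk rels p) := by cases b <;> simp [mk_eq]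
    simp only [map_mul, hside] at hu
    exact eq_base_of_mul_mul_eq_base hu
  obtain ⟨g', hg'⟩ := sides
  have hp := hρ p
  have hq := hρ q
  rw [← mk_eq] at hq
  rw [hg'] at hp hq
  have hpq : ρ p = ρ q := Eq.trans hp (Eq.symm hq)
  cases b <;> simp [Edge.value, hpq]

/-- Of two words with nonzero product, one represents an element of the group. If it is the first
one, both ends of `e₁` act equally; if it is the second one, the value of `e₂` vanishes. -/
theorem value_disjoint {u₁ v₁ u₂ v₂ : FreeMonoid L} (e₁ : Edge rels u₁ v₁) (e₂ : Edge rels u₂ v₂)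
    (hne : ψ (PresentedMonoid.mk rels (u₁ * u₂)) ≠ zero) :
    ((e₁.rmul u₂).path.comp (e₂.lmul v₁).path).value D ρ =
      ((e₂.lmul u₁).path.comp (e₁.rmul v₂).path).value D ρ := by
  simp only [DPath.value_comp, DPath.value_path, Edge.value_lmul, Edge.value_rmul]
  rw [map_mul, map_mul] at hne
  rcases eq_base_of_mul_ne_zero hne with ⟨g, hg⟩ | ⟨g, hg⟩
  · have hu := hρ u₁
    have hv := hρ v₁
    rw [← e₁.mk_eq_mk] at hv
    rw [hg] at hu hv
    rw [show ρ u₁ = g from hu, show ρ v₁ = g from hv, add_comm]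
  · rw [value_eq_zero_of_eq_base ψ hρ e₂ hg, smul_zero, smul_zero, add_zero, zero_add]

theorem isHomotopyRelation_value :
    IsHomotopyRelation rels fun u _ p q =>
      ψ (PresentedMonoid.mk rels u) ≠ zero → p.value D ρ = q.value D ρ where
  equiv _ _ := ⟨fun _ _ => rfl, fun h hu => (h hu).symm, fun h h' hu => (h hu).trans (h' hu)⟩
  disjoint := value_disjoint ψ hρ
  act p q x y h hne := by
    simp only [map_mul] at hne
    simp only [DPath.value_act, h (right_ne_zero_of_mul (left_ne_zero_of_mul hne))]
  comp r p q s h ht := by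
    simp only [DPath.value_comp, h (r.mk_eq_mk ▸ ht)]
  inv p _ := by simp [DPath.value]

variable (hD : IsCocycle₁ D) (htriv : ∀ k ∈ φ.ker, ∀ x : V, k • x = x)

include hD htriv

theorem edge_value_eq_sub {u v : FreeMonoid L} (e : Edge rels u v)
    (hu : ψ (PresentedMonoid.mk rels u) ≠ zero) : e.value D ρ = D (ρ u) - D (ρ v) := by
  have smul_eq (g g' : G) (hg : φ g = φ g') (x : V) : g • x = g' • x := by
    rw [← inv_smul_eq_iff, ← mul_smul]
    exact htriv _ (by rw [MonoidHom.mem_ker, map_mul, map_inv, hg, inv_mul_cancel]) x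
  have sides_eq : PresentedMonoid.mk rels (if e.pos = true then e.rule.1 else e.rule.2) =
      PresentedMonoid.mk rels (if e.pos = true then e.rule.2 else e.rule.1) := by
    cases e.pos <;> simp [PresentedMonoid.mk_eq_mk_of_rel e.rule_mem]
  rw [← e.src_eq, map_mul, map_mul] at hu
  have hsrc := hρ (e.left * if e.pos = true then e.rule.1 else e.rule.2)
  have htgt := hρ (e.left * if e.pos = true then e.rule.2 else e.rule.1)
  simp only [map_mul, sides_eq] at hsrc htgt hu
  have act_eq := smul_eq _ _ (hsrc.map_eq (left_ne_zero_of_mul hu) htgt)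
  have hDu := congrArg (D ∘ ρ) e.src_eq
  have hDv := congrArg (D ∘ ρ) e.tgt_eq
  simp only [Function.comp_apply, map_mul, hD _ _, act_eq] at hDu hDv
  rw [← hDu, ← hDv, Edge.value, smul_sub]
  abel

theorem value_eq_sub {u v : FreeMonoid L} (p : DPath rels u v)
    (hu : ψ (PresentedMonoid.mk rels u) ≠ zero) : p.value D ρ = D (ρ u) - D (ρ v) := by
  induction p with
  | nil => exact (sub_self _).symm
  | cons e p ih =>
    rw [DPath.value, edge_value_eq_sub ψ hρ hD htriv e hu, ih (e.mk_eq_mk ▸ hu), sub_add_sub_cancel]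

end Homotopy

end Layered

/-! ## Layered monoids without finite derivation type -/

section

variable {L : Type*} {rels : FreeMonoid L → FreeMonoid L → Prop} {G V : Type*} [Group G]
  [AddCommGroup V] [DistribMulAction G V] (D : G → V) (ρ : FreeMonoid L →* G)

theorem DPath.exists_value_eq_smul {u v : FreeMonoid L} (p : DPath rels u v)
    {x y u' v' : FreeMonoid L} (hu : x * u * y = u') (hv : x * v * y = v') :
    ∃ q : DPath rels u' v', q.value D ρ = ρ x • p.value D ρ := by
  subst hu hv
  exact ⟨p.act x y, p.value_act D ρ x y⟩

/-- There are two paths from `x * u * y` to `u`: one removes `y` before `x`, the other `x` before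
`y`. -/
theorem DPath.smul_value_eq_self {u x y : FreeMonoid L} (p : DPath rels (u * y) u)
    (q : DPath rels (x * u) u)
    (hval : ∀ r r' : DPath rels (x * u * y) u, r.value D ρ = r'.value D ρ) :
    ρ x • p.value D ρ = p.value D ρ := by
  obtain ⟨p', hp'⟩ := p.exists_value_eq_smul D ρ (x := x) (y := 1) (u' := x * u * y) (v' := x * u)
    (by simp [mul_assoc]) (by simp)
  obtain ⟨q', hq'⟩ := q.exists_value_eq_smul D ρ (x := 1) (y := y) (u' := x * u * y) (v' := u * y)
    (by simp) (by simp)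
  have h := hval (p'.comp q) (q'.comp p)
  rw [DPath.value_comp, DPath.value_comp, hp', hq', map_one, one_smul, add_comm] at h
  exact add_left_cancel h

end

theorem isCocycle₁_comp {G V W : Type*} [Group G] [AddCommGroup V] [AddCommGroup W]
    [DistribMulAction G V] [DistribMulAction G W] (f : V →+[G] W) {D : G → V}
    (hD : IsCocycle₁ D) : IsCocycle₁ (f ∘ D) := fun g g' => by
  simp only [Function.comp_apply, hD g g', map_add, map_smul]

namespace Layered

variable {G A : Type*} [Group G] [Group A] {φ : G →* A}
  {L : Type} {rels : FreeMonoid L → FreeMonoid L → Prop} {ρ : FreeMonoid L →* G}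
  {D : G → G →₀ ℤ} (hD : IsCocycle₁ D)

include hD

theorem exists_fg_forall_value_eq (hrels : PresentationHasFDT rels)
    (ψ : PresentedMonoid rels →* Layered φ false)
    (hρ : ∀ w, Represents (ρ w) (ψ (PresentedMonoid.mk rels w))) :
    ∃ H ≤ φ.ker, H.FG ∧ ∀ u v (p q : DPath rels u v), ψ (PresentedMonoid.mk rels u) ≠ zero →
      p.value (toCosets H ∘ D) ρ = q.value (toCosets H ∘ D) ρ := by
  obtain ⟨C, hC, base⟩ := hrels
  let difference (c : ParallelPair rels) : G →₀ ℤ := c.fst.value D ρ - c.snd.value D ρ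
  let C' : Set (ParallelPair rels) := {c ∈ C | ψ (PresentedMonoid.mk rels c.src) ≠ zero}
  have toCosets_ker : ∀ F ∈ difference '' C', toCosets φ.ker F = 0 := by
    rintro _ ⟨c, ⟨-, hc⟩, rfl⟩
    rw [map_sub, ← DPath.value_map, ← DPath.value_map]
    simp only [value_eq_sub ψ hρ (isCocycle₁_comp _ hD) (fun _ hk => smul_eq_self_of_mem hk) _ hc,
      sub_self]
  have finite_differences : (difference '' C').Finite := (hC.subset (Set.sep_subset _ _)).image _
  obtain ⟨H, hHK, hH, hzero⟩ := exists_fg_toCosets_eq_zero φ.ker finite_differences toCosets_ker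
  refine ⟨H, hHK, hH, fun u v p q => base p q _ (isHomotopyRelation_value ψ hρ) fun c hc hsrc => ?_⟩
  rw [DPath.value_map, DPath.value_map, ← sub_eq_zero, ← map_sub]
  exact hzero _ ⟨c, ⟨hc, hsrc⟩, rfl⟩

theorem fg_ker_of_forall_value_eq (ψ : PresentedMonoid rels ≃* Layered φ false)
    (hρ : ∀ w, Represents (ρ w) (ψ (PresentedMonoid.mk rels w)))
    {H : Subgroup G} (hHK : H ≤ φ.ker) (hH : H.FG)
    (hval : ∀ u v (p q : DPath rels u v), ψ (PresentedMonoid.mk rels u) ≠ zero →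
      p.value (toCosets H ∘ D) ρ = q.value (toCosets H ∘ D) ρ)
    {k' : G} (hk' : k' ∈ φ.ker) (hDk' : toCosets φ.ker (D k') ≠ 0) : φ.ker.FG := by
  have exists_word (x : Layered φ false) : ∃ w, ψ (PresentedMonoid.mk rels w) = x :=
    ψ.surjective.comp PresentedMonoid.surjective_mk x
  have exists_path {u v : FreeMonoid L} (h : ψ (PresentedMonoid.mk rels u) =
      ψ (PresentedMonoid.mk rels v)) : Nonempty (DPath rels u v) :=
    nonempty_dPath_of_mk_eq (ψ.injective h)
  obtain ⟨η, hη⟩ := exists_word (mid 1)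
  obtain ⟨w', hw'⟩ := exists_word (base k')
  have hρw' : ρ w' = k' := by
    have := hρ w'
    rwa [hw'] at this
  obtain ⟨p⟩ : Nonempty (DPath rels (η * w') η) :=
    exists_path (by simp [hη, hw', MonoidHom.mem_ker.1 hk'])
  have value_invariant : ∀ k ∈ φ.ker,
      k • p.value (toCosets H ∘ D) ρ = p.value (toCosets H ∘ D) ρ := by
    intro k hk
    obtain ⟨w, hw⟩ := exists_word (base k)
    have hρw : ρ w = k := by
      have := hρ w
      rwa [hw] at this
    obtain ⟨r⟩ : Nonempty (DPath rels (w * η) η) :=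
      exists_path (by simp [hη, hw, MonoidHom.mem_ker.1 hk])
    have value_smul := p.smul_value_eq_self (toCosets H ∘ D) ρ r fun _ _ =>
      hval _ _ _ _ (by simp [hη, hw, hw'])
    rwa [hρw] at value_smul
  refine fg_of_forall_smul_eq hHK hH (fun hzero => hDk' ?_) value_invariant
  have value_ker : p.value (toCosets φ.ker ∘ D) ρ = 0 := by
    rw [DPath.value_map] at hzero ⊢
    exact toCosets_eq_zero_of_le hHK hzero
  rw [value_eq_sub ψ.toMonoidHom hρ (isCocycle₁_comp _ hD) (fun _ hk => smul_eq_self_of_mem hk) p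
    (by simp [hη, hw']), map_mul, isCocycle₁_comp _ hD, hρw', add_sub_cancel_right,
    smul_eq_zero_iff_eq] at value_ker
  exact value_ker

theorem not_hasFDT (hφ : Function.Surjective φ) [Infinite A] {S : Type*} [Monoid S]
    (e : S ≃* Layered φ false) {k : G} (hk : k ∈ φ.ker) (hDk : toCosets φ.ker (D k) ≠ 0) :
    ¬ HasFDT S := by
  rintro ⟨L, rels, -, -, ⟨e'⟩, hrels⟩
  let ψ := e'.symm.trans e
  obtain ⟨ρ, hρ⟩ := exists_monoidHom_represents hφ (ψ.toMonoidHom.comp (PresentedMonoid.mk rels))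
  obtain ⟨H, hHK, hH, hval⟩ := exists_fg_forall_value_eq hD hrels ψ.toMonoidHom hρ
  have : Infinite (G ⧸ φ.ker) :=
    (QuotientGroup.quotientKerEquivOfSurjective φ hφ).toEquiv.infinite_iff.2 ‹_›
  exact not_fg_of_isCocycle₁ (isCocycle₁_comp _ hD) hk hDk
    (fg_ker_of_forall_value_eq hD ψ hρ hHK hH hval hk hDk)

end Layered

/-! ## The free group of rank two and its exponent sums -/

/-- On a free group a cocycle can be prescribed arbitrarily on the generators: a cocycle with values
in `V` is a section of the semidirect product of `V` with the group. -/
theorem exists_isCocycle₁_freeGroup {α V : Type*} [AddCommGroup V]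
    [DistribMulAction (FreeGroup α) V] (d : α → V) :
    ∃ D : FreeGroup α → V, IsCocycle₁ D ∧ ∀ x, D (.of x) = d x := by
  let act : FreeGroup α →* MulAut (Multiplicative V) :=
    (MulAutMultiplicative V).symm.toMonoidHom.comp (DistribMulAction.toAddAut (FreeGroup α) V)
  let s : FreeGroup α →* Multiplicative V ⋊[act] FreeGroup α :=
    FreeGroup.lift fun x => ⟨.ofAdd (d x), .of x⟩
  have right_s (g : FreeGroup α) : (s g).right = g :=
    DFunLike.congr_fun (FreeGroup.ext_hom (SemidirectProduct.rightHom.comp s) (MonoidHom.id _)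
      fun x => by simp [s]) g
  refine ⟨fun g => (s g).left.toAdd, fun g g' => ?_, fun x => by simp [s]⟩
  simp only [map_mul, SemidirectProduct.mul_left, right_s, toAdd_mul, add_comm]
  rfl

theorem isCocycle₁_commutator {G V : Type*} [Group G] [AddCommGroup V] [DistribMulAction G V]
    {D : G → V} (hD : IsCocycle₁ D) {g : G} (hg : D g = 0) (g' : G) :
    D ⁅g, g'⁆ = g • D g' - ⁅g, g'⁆ • D g' := by
  have inv_eq (x : G) : D x⁻¹ = -(x⁻¹ • D x) := by
    rw [← smul_neg, ← map_inv_of_isCocycle₁ hD, inv_smul_smul]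
  simp only [commutatorElement_def, hD _ _, inv_eq, hg, smul_neg, smul_zero, mul_smul]
  abel

/-- The exponent sums of an element of the free group of rank two. -/
def expSum : FreeGroup Bool →* Multiplicative ℤ × Multiplicative ℤ :=
  FreeGroup.lift fun b => if b then (1, .ofAdd 1) else (.ofAdd 1, 1)

@[simp] theorem expSum_of (b : Bool) :
    expSum (.of b) = if b then (1, .ofAdd 1) else (.ofAdd 1, 1) := FreeGroup.lift_apply_of

theorem expSum_surjective : Function.Surjective expSum := by
  rintro ⟨i, j⟩
  refine ⟨.of false ^ i.toAdd * .of true ^ j.toAdd, ?_⟩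
  rw [map_mul, map_zpow, map_zpow, expSum_of, expSum_of]
  ext <;> simp [← ofAdd_zsmul]

theorem commutator_mem_ker_expSum (g g' : FreeGroup Bool) : ⁅g, g'⁆ ∈ expSum.ker := by
  rw [MonoidHom.mem_ker, map_commutatorElement, commutatorElement_eq_one_iff_mul_comm, mul_comm]

theorem ker_expSum_le {S : Subgroup (FreeGroup Bool)} [S.Normal]
    (hS : ⁅FreeGroup.of false, FreeGroup.of true⁆ ∈ S) : expSum.ker ≤ S := by
  let q : FreeGroup Bool →* FreeGroup Bool ⧸ S := QuotientGroup.mk' S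
  have comm : Commute (q (.of false)) (q (.of true)) := by
    rw [← commutatorElement_eq_one_iff_commute, ← map_commutatorElement]
    exact (QuotientGroup.eq_one_iff _).2 hS
  let χ : Multiplicative ℤ × Multiplicative ℤ →* FreeGroup Bool ⧸ S :=
    (zpowersHom _ (q (.of false))).noncommCoprod (zpowersHom _ (q (.of true))) fun i j =>
      (comm.zpow_left i.toAdd).zpow_right j.toAdd
  have factor : χ.comp expSum = q := FreeGroup.ext_hom _ _ fun c => by
    rw [MonoidHom.comp_apply, expSum_of]
    exact (MonoidHom.noncommCoprod_apply _ _ _ _).trans (by cases c <;> simp)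
  intro g hg
  rw [← QuotientGroup.eq_one_iff, ← QuotientGroup.mk'_apply]
  change q g = 1
  rw [← factor, MonoidHom.comp_apply, MonoidHom.mem_ker.1 hg, map_one]

theorem mul_map_eq_of_expSum_eq {P : Type*} [Monoid P] {f : FreeGroup Bool →* P} {h : P}
    (comm : ∀ g, f g * h = h * f g)
    (swap : h * f (.of false) * f (.of true) = h * f (.of true) * f (.of false))
    {g g' : FreeGroup Bool} (hgg' : expSum g = expSum g') : h * f g = h * f g' := by
  let S : Subgroup (FreeGroup Bool) :=
    { carrier := {x | h * f x = h}
      one_mem' := by simp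
      mul_mem' := fun {x y} (hx : h * f x = h) (hy : h * f y = h) => by
        rw [Set.mem_ofPred_eq, map_mul, ← mul_assoc, hx, hy]
      inv_mem' := fun {x} (hx : h * f x = h) => by
        rw [Set.mem_ofPred_eq]
        conv_lhs => rw [← hx, mul_assoc, ← map_mul, mul_inv_cancel, map_one, mul_one] }
  have : S.Normal := ⟨fun x (hx : h * f x = h) y => by
    change h * f (y * x * y⁻¹) = h
    rw [map_mul, map_mul, ← mul_assoc, ← mul_assoc, ← comm, mul_assoc (f y), hx, comm, mul_assoc,
      ← map_mul, mul_inv_cancel, map_one, mul_one]⟩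
  have commutator_mem : ⁅FreeGroup.of false, FreeGroup.of true⁆ ∈ S := by
    change h * f _ = h
    rw [commutatorElement_def, map_mul, map_mul, map_mul, ← mul_assoc, ← mul_assoc, ← mul_assoc,
      swap]
    simp only [mul_assoc, ← map_mul, mul_inv_cancel, map_one, mul_one]
  have quotient_mem : h * f (g * g'⁻¹) = h :=
    ker_expSum_le commutator_mem (by rw [MonoidHom.mem_ker, map_mul, map_inv, hgg', mul_inv_cancel])
  rw [← inv_mul_cancel_right g g', map_mul, ← mul_assoc, quotient_mem]

theorem exists_isCocycle₁_toCosets_ne_zero :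
    ∃ D : FreeGroup Bool → FreeGroup Bool →₀ ℤ, IsCocycle₁ D ∧
      ∃ k ∈ expSum.ker, toCosets expSum.ker (D k) ≠ 0 := by
  obtain ⟨D, hD, D_of⟩ := exists_isCocycle₁_freeGroup (α := Bool)
    fun c => if c then Finsupp.single (1 : FreeGroup Bool) (1 : ℤ) else 0
  have a_notMem : FreeGroup.of false ∉ expSum.ker := by simp [MonoidHom.mem_ker]
  refine ⟨D, hD, _, commutator_mem_ker_expSum (.of false) (.of true), fun hzero => a_notMem ?_⟩
  rw [isCocycle₁_commutator hD (by simp [D_of]), map_sub, map_smul, map_smul,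
    smul_eq_self_of_mem (commutator_mem_ker_expSum _ _), sub_eq_zero] at hzero
  simp only [D_of, if_true, toCosets_apply, Finsupp.mapDomain_single, Finsupp.comapSMul_single]
    at hzero
  rw [← QuotientGroup.eq_one_iff, ← mul_one (FreeGroup.of false)]
  exact Finsupp.single_left_injective one_ne_zero hzero

end Cocycles

section Models

open FreeMonoid Gen

/-! ## The two monoids as layered monoids -/

instance : Finite Gen := by
  refine Set.finite_univ_iff.1 ((Set.toFinite {a, aInv, b, bInv, h, z}).subset ?_)
  rintro (_ | _ | _ | _ | _ | _) - <;> simp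

/-- The layered monoid over the exponent sums of the free group of rank two. It is isomorphic to
`M` for `idem = false` and to `N` for `idem = true`. -/
abbrev Model (idem : Bool) : Type := Layered expSum idem

/-- The element of the free group of rank two that a group letter stands for; the values at `h` and
`z` are irrelevant. -/
def Gen.toGroup : Gen → FreeGroup Bool
  | a => .of false
  | aInv => (.of false)⁻¹
  | b => .of true
  | bInv => (.of true)⁻¹
  | h => 1
  | z => 1

/-- The elements of the model that the six generators represent. -/
def Gen.model (idem : Bool) : Gen → Model idem
  | h => .mid 1
  | z => .zero
  | x => .base x.toGroup

theorem Gen.model_h (idem : Bool) : h.model idem = .mid 1 := rfl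

theorem Gen.model_eq_base {x : Gen} (hx : x ∈ groupLetters) (idem : Bool) :
    x.model idem = .base x.toGroup := by
  rcases hx with rfl | rfl | rfl | rfl <;> rfl

theorem Gen.forall_of_groupLetters {p : Gen → Prop} (letters : ∀ x ∈ groupLetters, p x) (h' : p h)
    (z' : p z) (x : Gen) : p x := by
  cases x
  case h => exact h'
  case z => exact z'
  all_goals exact letters _ (by simp [groupLetters])

theorem Gen.mem_of_groupLetters {S : Submonoid (FreeGroup Bool)}
    (hS : ∀ x ∈ groupLetters, x.toGroup ∈ S) (g : FreeGroup Bool) : g ∈ S := by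
  refine FreeGroup.induction_on g S.one_mem (fun c => ?_) (fun c _ => ?_) fun _ _ => S.mul_mem
  · cases c
    · exact hS a (by simp [groupLetters])
    · exact hS b (by simp [groupLetters])
  · cases c
    · exact hS aInv (by simp [groupLetters])
    · exact hS bInv (by simp [groupLetters])

theorem CommonRel.lift_model_eq (idem : Bool) {u v : FreeMonoid Gen} (huv : CommonRel u v) :
    FreeMonoid.lift (Gen.model idem) u = FreeMonoid.lift (Gen.model idem) v := by
  cases huv with
  | comm_h x hx => simp [Gen.model_eq_base hx, Gen.model_h]
  | h_comm x y hx hy =>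
    simp [Gen.model_eq_base hx, Gen.model_eq_base hy, Gen.model_h, mul_comm]
  | _ => simp [Gen.model, Gen.toGroup, Layered.one_def]

theorem MRel.lift_model_eq {u v : FreeMonoid Gen} (huv : MRel u v) :
    FreeMonoid.lift (Gen.model false) u = FreeMonoid.lift (Gen.model false) v := by
  cases huv with
  | common h => exact h.lift_model_eq _
  | _ => simp [Gen.model, pow_succ]

theorem NRel.lift_model_eq {u v : FreeMonoid Gen} (huv : NRel u v) :
    FreeMonoid.lift (Gen.model true) u = FreeMonoid.lift (Gen.model true) v := by
  cases huv with
  | common h => exact h.lift_model_eq _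
  | _ => simp [Gen.model, pow_succ]

theorem closure_range_model (idem : Bool) :
    Submonoid.closure (Set.range (Gen.model idem)) = ⊤ := by
  set S := Submonoid.closure (Set.range (Gen.model idem))
  have model_mem (x : Gen) : x.model idem ∈ S := Submonoid.subset_closure ⟨x, rfl⟩
  refine (Submonoid.eq_top_iff' _).2 <| Layered.mem_of_mrange_baseHom_le expSum_surjective ?_
    (model_mem h) (model_mem z)
  rintro _ ⟨g, rfl⟩
  exact Gen.mem_of_groupLetters (S := S.comap (Layered.baseHom expSum idem))
    (fun x hx => by simpa [Gen.model_eq_base hx] using model_mem x) g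

section Presentation

variable {P : Type*} [Monoid P] {f : Gen → P}

theorem exists_monoidHom_toGroup
    (hf : ∀ u v, CommonRel u v → FreeMonoid.lift f u = FreeMonoid.lift f v) :
    ∃ F : FreeGroup Bool →* P, ∀ x ∈ groupLetters, F x.toGroup = f x := by
  have a_aInv : f a * f aInv = 1 := by simpa using hf _ _ .a_aInv
  have aInv_a : f aInv * f a = 1 := by simpa using hf _ _ .aInv_a
  have b_bInv : f b * f bInv = 1 := by simpa using hf _ _ .b_bInv
  have bInv_b : f bInv * f b = 1 := by simpa using hf _ _ .bInv_b
  let unit : Bool → Pˣ := fun c =>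
    if c then ⟨f b, f bInv, b_bInv, bInv_b⟩ else ⟨f a, f aInv, a_aInv, aInv_a⟩
  refine ⟨(Units.coeHom P).comp (FreeGroup.lift unit), fun x hx => ?_⟩
  rcases hx with rfl | rfl | rfl | rfl <;>
    simp only [Gen.toGroup, MonoidHom.comp_apply, map_inv, FreeGroup.lift_apply_of] <;> rfl

theorem mul_eq_self_of_closure_eq_top {s : Set P} (hs : Submonoid.closure s = ⊤) {z : P}
    (hz : ∀ x ∈ s, z * x = z) (p : P) : z * p = z := by
  have hp : p ∈ Submonoid.closure s := hs ▸ Submonoid.mem_top p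
  induction hp using Submonoid.closure_induction with
  | mem x hx => exact hz x hx
  | one => exact mul_one z
  | mul x y _ _ ihx ihy => rw [← mul_assoc, ihx, ihy]

theorem mul_eq_right_of_closure_eq_top {s : Set P} (hs : Submonoid.closure s = ⊤) {z : P}
    (hz : ∀ x ∈ s, x * z = z) (p : P) : p * z = z := by
  have hp : p ∈ Submonoid.closure s := hs ▸ Submonoid.mem_top p
  induction hp using Submonoid.closure_induction with
  | mem x hx => exact hz x hx
  | one => exact one_mul z
  | mul x y _ _ ihx ihy => rw [mul_assoc, ihy, ihx]

theorem exists_monoidHom_model {idem : Bool} (hgen : Submonoid.closure (Set.range f) = ⊤)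
    (hf : ∀ u v, CommonRel u v → FreeMonoid.lift f u = FreeMonoid.lift f v)
    (z_mul : ∀ x, f z * f x = f z) (mul_z : ∀ x, f x * f z = f z)
    (sq : f h * f h = if idem then f h else f z) :
    ∃ F : Model idem →* P, ∀ x, F (x.model idem) = f x := by
  obtain ⟨F, hF⟩ := exists_monoidHom_toGroup hf
  have comm (g : FreeGroup Bool) : F g * f h = f h * F g := by
    refine Gen.mem_of_groupLetters (S :=
      { carrier := {g | Commute (F g) (f h)}
        one_mem' := by simp
        mul_mem' := fun hx hy => by simpa using Commute.mul_left hx hy }) (fun x hx => ?_) g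
    change F x.toGroup * f h = f h * F x.toGroup
    simpa [hF x hx] using hf _ _ (.comm_h x hx)
  have swap : f h * F (.of false) * F (.of true) = f h * F (.of true) * F (.of false) := by
    have ha : a ∈ groupLetters := by simp [groupLetters]
    have hb : b ∈ groupLetters := by simp [groupLetters]
    change f h * F a.toGroup * F b.toGroup = f h * F b.toGroup * F a.toGroup
    simpa [hF a ha, hF b hb] using hf _ _ (.h_comm a b ha hb)
  exact ⟨Layered.lift expSum_surjective F (f h) (f z) comm
    (fun _ _ => mul_map_eq_of_expSum_eq comm swap) sq
    (mul_eq_self_of_closure_eq_top hgen (Set.forall_mem_range.2 z_mul))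
    (mul_eq_right_of_closure_eq_top hgen (Set.forall_mem_range.2 mul_z)),
    Gen.forall_of_groupLetters
      (fun x hx => by rw [Gen.model_eq_base hx, Layered.lift_base, hF x hx])
      (Layered.lift_mid_one ..) (Layered.lift_zero ..)⟩

end Presentation

theorem lift_of_eq {A : Type*} {rels : FreeMonoid A → FreeMonoid A → Prop}
    {u v : FreeMonoid A} (huv : rels u v) :
    FreeMonoid.lift (PresentedMonoid.of rels) u = FreeMonoid.lift (PresentedMonoid.of rels) v := by
  have lift_of : FreeMonoid.lift (PresentedMonoid.of rels) = PresentedMonoid.mk rels :=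
    FreeMonoid.hom_eq fun x => FreeMonoid.lift_eval_of _ x
  rw [lift_of]
  exact PresentedMonoid.mk_eq_mk_of_rel huv

theorem exists_mulEquiv_model {idem : Bool} {rels : FreeMonoid Gen → FreeMonoid Gen → Prop}
    (sound : ∀ u v, rels u v →
      FreeMonoid.lift (Gen.model idem) u = FreeMonoid.lift (Gen.model idem) v)
    (common : ∀ u v, CommonRel u v → rels u v)
    (z_mul : ∀ x, PresentedMonoid.of rels z * PresentedMonoid.of rels x = PresentedMonoid.of rels z)
    (mul_z : ∀ x, PresentedMonoid.of rels x * PresentedMonoid.of rels z = PresentedMonoid.of rels z)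
    (sq : PresentedMonoid.of rels h * PresentedMonoid.of rels h =
      if idem then PresentedMonoid.of rels h else PresentedMonoid.of rels z) :
    ∃ e : PresentedMonoid rels ≃* Model idem,
      ∀ x, e (PresentedMonoid.of rels x) = x.model idem := by
  obtain ⟨F, hF⟩ := exists_monoidHom_model (PresentedMonoid.closure_range_of rels)
    (fun u v huv => lift_of_eq (common u v huv)) z_mul mul_z sq
  refine ⟨MonoidHom.toMulEquiv (PresentedMonoid.lift (Gen.model idem) sound) F ?_ ?_,
    fun _ => rfl⟩
  · exact PresentedMonoid.ext _ fun x => by simp [hF]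
  · exact MonoidHom.eq_of_eqOn_denseM (closure_range_model idem)
      (by rintro _ ⟨x, rfl⟩; simp [hF])

theorem exists_mulEquiv_N :
    ∃ e : PresentedMonoid NRel ≃* Model true, ∀ x, e (PresentedMonoid.of NRel x) = x.model true :=
  exists_mulEquiv_model (fun _ _ => NRel.lift_model_eq) (fun _ _ => .common)
    (fun x => by simpa using lift_of_eq (NRel.z_mul x))
    (fun x => by simpa using lift_of_eq (NRel.mul_z x))
    (by simpa [pow_two] using lift_of_eq NRel.h_idem)

theorem exists_mulEquiv_M :
    ∃ e : PresentedMonoid MRel ≃* Model false,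
      ∀ x, e (PresentedMonoid.of MRel x) = x.model false := by
  set f := PresentedMonoid.of MRel with f_def
  have hh : f h * f h = f z := by simpa [pow_two] using lift_of_eq MRel.hsq_z
  have z_eq_sq : f z = f h ^ 2 := by rw [pow_two, hh]
  have z_mul_h : f z * f h = f z := by
    simpa [z_eq_sq, ← f_def, ← pow_succ] using lift_of_eq MRel.h_cube
  have z_mul_z : f z * f z = f z := by
    conv_lhs => rw [← hh, ← mul_assoc, hh, z_mul_h, z_mul_h]
  have z_mul : ∀ x, f z * f x = f z := by
    refine Gen.forall_of_groupLetters (fun x hx => ?_) z_mul_h z_mul_z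
    simpa [z_eq_sq, ← f_def] using lift_of_eq (MRel.hsq_mul x hx)
  have comm_h (x : Gen) (hx : x ∈ groupLetters) : Commute (f x) (f h) := by
    simpa [commute_iff_eq] using lift_of_eq (MRel.common (.comm_h x hx))
  have comm_z : ∀ x, Commute (f x) (f z) := by
    rw [z_eq_sq]
    exact Gen.forall_of_groupLetters (fun x hx => (comm_h x hx).pow_right 2)
      (Commute.self_pow _ 2) (by rw [z_eq_sq])
  exact exists_mulEquiv_model (fun _ _ => MRel.lift_model_eq) (fun _ _ => .common) z_mul
    (fun x => (comm_z x).eq.trans (z_mul x)) hh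

theorem not_hasFDT_M : ¬ HasFDT (PresentedMonoid MRel) := by
  obtain ⟨e, -⟩ := exists_mulEquiv_M
  obtain ⟨D, hD, k, hk, hDk⟩ := exists_isCocycle₁_toCosets_ne_zero
  exact Layered.not_hasFDT hD expSum_surjective e hk hDk

/-! ## The isometry -/

section Isometric

variable {X Y Z : Type*} {dX : Semimetric X} {dY : Semimetric Y} {dZ : Semimetric Z}

theorem Isometric.symm (h : Isometric dX dY) : Isometric dY dX := by
  obtain ⟨f, hf⟩ := h
  exact ⟨f.symm, fun x y => by rw [← hf, f.apply_symm_apply, f.apply_symm_apply]⟩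

theorem Isometric.trans (h : Isometric dX dY) (h' : Isometric dY dZ) : Isometric dX dZ := by
  obtain ⟨f, hf⟩ := h
  obtain ⟨f', hf'⟩ := h'
  exact ⟨f.trans f', fun x y => (hf' _ _).trans (hf x y)⟩

end Isometric

section wordDist

variable {A B S T : Type*} [Monoid S] [Monoid T] {g : A → S} {k : B → T}

theorem wordDist_mul_le_one (g : A → S) (x : S) (s : A) : wordDist g x (x * g s) ≤ 1 := by
  simpa using wordDist_le g x (.of s)

theorem wordDist_map_le {f : S → T} (hf : ∀ x s, wordDist k (f x) (f (x * g s)) ≤ 1) (x y : S) :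
    wordDist k (f x) (f y) ≤ wordDist g x y := by
  refine le_iInf ?_
  rintro ⟨w, rfl⟩
  dsimp only
  induction w using FreeMonoid.inductionOn' generalizing x with
  | one => simp [(wordDist_eq_zero k (f x) (f x)).2 rfl]
  | of_mul s w ih =>
    calc wordDist k (f x) (f (x * FreeMonoid.lift g (.of s * w)))
        ≤ wordDist k (f x) (f (x * g s)) +
            wordDist k (f (x * g s)) (f (x * g s * FreeMonoid.lift g w)) := by
          rw [map_mul, FreeMonoid.lift_eval_of, ← mul_assoc]
          exact wordDist_triangle ..
      _ ≤ 1 + w.length := add_le_add (hf x s) (ih (x * g s))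
      _ = (FreeMonoid.of s * w).length := by simp

theorem isometric_of_wordDist_le_one (f : S ≃ T)
    (hf : ∀ x s, wordDist k (f x) (f (x * g s)) ≤ 1)
    (hf_symm : ∀ y t, wordDist g (f.symm y) (f.symm (y * k t)) ≤ 1) :
    Isometric (cayleySemimetric g) (cayleySemimetric k) := by
  refine ⟨f, fun x y => le_antisymm (wordDist_map_le hf x y) ?_⟩
  change wordDist g x y ≤ wordDist k (f x) (f y)
  simpa using wordDist_map_le hf_symm (f x) (f y)

theorem isometric_of_mulEquiv {k : A → T} (e : S ≃* T) (he : ∀ s, e (g s) = k s) :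
    Isometric (cayleySemimetric g) (cayleySemimetric k) :=
  isometric_of_wordDist_le_one e.toEquiv
    (fun x s => by simpa [he] using wordDist_mul_le_one k (e x) s)
    (fun y s => by simpa [← he] using wordDist_mul_le_one g (e.symm y) s)

end wordDist

/-- The identity on the common underlying set of the layered monoids with `h * h = 0` and with
`h * h = h`. -/
def Layered.relabel {G A : Type*} [Monoid G] [Monoid A] (φ : G →* A) (i j : Bool) :
    Layered φ i ≃ Layered φ j where
  toFun | base g => base g | mid α => mid α | zero => zero
  invFun | base g => base g | mid α => mid α | zero => zero
  left_inv x := by cases x <;> rfl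
  right_inv x := by cases x <;> rfl

theorem wordDist_relabel_le_one (i j : Bool) (x : Model i) (s : Gen) :
    wordDist (Gen.model j) (Layered.relabel expSum i j x)
      (Layered.relabel expSum i j (x * s.model i)) ≤ 1 := by
  have of_mul_eq {y y' : Model j} (t : Gen) (hy : y * t.model j = y') :
      wordDist (Gen.model j) y y' ≤ 1 := hy ▸ wordDist_mul_le_one _ y t
  by_cases hx : s = h ∧ ∃ α, x = .mid α
  -- Where `h * h = 0`, the generator `z` replaces `h`; where `h * h = h`, no letter is needed.
  · obtain ⟨rfl, α, rfl⟩ := hx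
    cases i <;> cases j
    · exact of_mul_eq h rfl
    · exact of_mul_eq z rfl
    · exact ((wordDist_eq_zero _ _ _).2 (by simp [Gen.model_h])).trans_le zero_le_one
    · exact of_mul_eq h rfl
  · refine of_mul_eq s ?_
    cases x <;> cases s <;> first | rfl | simp at hx

theorem isometric_model : Isometric (cayleySemimetric (Gen.model false))
    (cayleySemimetric (Gen.model true)) :=
  isometric_of_wordDist_le_one (Layered.relabel expSum false true)
    (wordDist_relabel_le_one false true) (wordDist_relabel_le_one true false)

theorem isometric_M_N : Isometric (cayleySemimetric (PresentedMonoid.of MRel))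
    (cayleySemimetric (PresentedMonoid.of NRel)) := by
  obtain ⟨eM, hM⟩ := exists_mulEquiv_M
  obtain ⟨eN, hN⟩ := exists_mulEquiv_N
  exact (isometric_of_mulEquiv eM hM).trans <|
    isometric_model.trans (isometric_of_mulEquiv eN hN).symm

end Models

section CompletePresentations

open FreeMonoid

/-! ## Complete rewriting systems from normal forms -/

theorem HasFiniteCompletePresentation.of_mulEquiv {S T : Type*} [Monoid S] [Monoid T]
    (h : HasFiniteCompletePresentation T) (e : S ≃* T) : HasFiniteCompletePresentation S := by
  obtain ⟨A, rels, finA, fin, complete, ⟨e'⟩⟩ := h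
  exact ⟨A, rels, finA, fin, complete, ⟨e.trans e'⟩⟩

section NormalForm

variable {A S : Type*} [Monoid S] {rels : FreeMonoid A → FreeMonoid A → Prop} {f : A → S}

theorem Reduces.lift_eq (hf : ∀ u v, rels u v → FreeMonoid.lift f u = FreeMonoid.lift f v)
    {u v : FreeMonoid A} (h : Reduces rels u v) : FreeMonoid.lift f u = FreeMonoid.lift f v :=
  congrArg (PresentedMonoid.lift f hf) (Reduces.mk_eq_mk h)

variable {nf : S → FreeMonoid A}

theorem reduces_normalForm (one : Reduces rels 1 (nf 1))
    (mul : ∀ x m, Reduces rels (of x * nf m) (nf (f x * m))) (w : FreeMonoid A) :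
    Reduces rels w (nf (FreeMonoid.lift f w)) := by
  induction w using FreeMonoid.inductionOn' with
  | one => simpa using one
  | of_mul x w ih =>
    rw [map_mul, FreeMonoid.lift_eval_of]
    exact (Reduces.mul_left _ ih).trans (mul x _)

theorem isConfluent_of_reduces
    (hf : ∀ u v, rels u v → FreeMonoid.lift f u = FreeMonoid.lift f v)
    (hnf : ∀ w, Reduces rels w (nf (FreeMonoid.lift f w))) : IsConfluent rels := fun w u v hu hv =>
  ⟨nf (FreeMonoid.lift f w), Reduces.lift_eq hf hu ▸ hnf u, Reduces.lift_eq hf hv ▸ hnf v⟩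

theorem lift_bijective_of_reduces (hgen : Submonoid.closure (Set.range f) = ⊤)
    (hf : ∀ u v, rels u v → FreeMonoid.lift f u = FreeMonoid.lift f v)
    (hnf : ∀ w, Reduces rels w (nf (FreeMonoid.lift f w))) :
    Function.Bijective (PresentedMonoid.lift f hf) := by
  constructor
  · intro p q hpq
    induction p with | _ u
    induction q with | _ v
    change FreeMonoid.lift f u = FreeMonoid.lift f v at hpq
    rw [Reduces.mk_eq_mk (hnf u), hpq, ← Reduces.mk_eq_mk (hnf v)]
  · intro s
    obtain ⟨w, rfl⟩ : s ∈ MonoidHom.mrange (FreeMonoid.lift f) := by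
      rw [FreeMonoid.mrange_lift, hgen]
      trivial
    exact ⟨PresentedMonoid.mk rels w, rfl⟩

end NormalForm

theorem hasFiniteCompletePresentation_of_normalForm {A : Type} [Finite A] {S : Type*} [Monoid S]
    {rels : FreeMonoid A → FreeMonoid A → Prop} {f : A → S} {nf : S → FreeMonoid A}
    (fin : FiniteRules rels) (noeth : IsNoetherian rels)
    (hgen : Submonoid.closure (Set.range f) = ⊤)
    (hf : ∀ u v, rels u v → FreeMonoid.lift f u = FreeMonoid.lift f v)
    (one : Reduces rels 1 (nf 1)) (mul : ∀ x m, Reduces rels (of x * nf m) (nf (f x * m))) :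
    HasFiniteCompletePresentation S :=
  have hnf := reduces_normalForm one mul
  ⟨A, rels, inferInstance, fin, ⟨noeth, isConfluent_of_reduces hf hnf⟩,
    ⟨(MulEquiv.ofBijective _ (lift_bijective_of_reduces hgen hf hnf)).symm⟩⟩

section Weight

variable {A α : Type*} {act : A → α → α}

/-- The value at `n` of a word whose letters are interpreted by functions, the first letter being
applied first. -/
def weight (act : A → α → α) (w : FreeMonoid A) (n : α) : α :=
  w.toList.foldl (fun n x => act x n) n

@[simp] theorem weight_one (n : α) : weight act 1 n = n := rfl

@[simp] theorem weight_of (x : A) (n : α) : weight act (of x) n = act x n := rfl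

@[simp] theorem weight_mul (u v : FreeMonoid A) (n : α) :
    weight act (u * v) n = weight act v (weight act u n) := by
  simp [weight]

theorem weight_strictMono [Preorder α] (hact : ∀ x, StrictMono (act x)) (w : FreeMonoid A) :
    StrictMono (weight act w) := by
  induction w using FreeMonoid.inductionOn' with
  | one => exact strictMono_id
  | of_mul x w ih =>
    intro m n hmn
    simpa using ih (hact x hmn)

theorem isNoetherian_of_weight_lt [LinearOrder α] [WellFoundedLT α]
    {rels : FreeMonoid A → FreeMonoid A → Prop} (hact : ∀ x, StrictMono (act x)) (n₀ : α)
    (hrels : ∀ l r, rels l r → ∀ n ≥ n₀, weight act r n < weight act l n) :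
    IsNoetherian rels := by
  rintro ⟨f, hf⟩
  have anti (i : ℕ) : weight act (f (i + 1)) n₀ < weight act (f i) n₀ := by
    obtain ⟨w₁, l, r, w₂, hlr, e, e'⟩ := hf i
    rw [e, e', weight_mul, weight_mul, weight_mul, weight_mul]
    exact weight_strictMono hact w₂ (hrels l r hlr _ (weight_strictMono hact w₁).le_apply)
  exact not_strictAnti_of_wellFoundedLT _
    (strictAnti_nat_of_succ_lt (f := fun i => weight act (f i) n₀) anti)

end Weight

/-! ## A finite complete presentation of `N` -/

/-- The letters of a complete presentation of `N`: the letters `g y` of the free group, the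
products `c y` of these letters with the idempotent `h`, the idempotent `h` and the zero `z`. A
letter of the free group is encoded as in `FreeGroup.mk`. -/
inductive ExtGen
  | g (y : Bool × Bool)
  | c (y : Bool × Bool)
  | h
  | z

open ExtGen

instance : Finite ExtGen := by
  let decode : (Bool × Bool) ⊕ (Bool × Bool) ⊕ Bool → ExtGen :=
    Sum.elim g (Sum.elim c fun b => if b then h else z)
  refine Finite.of_surjective decode ?_
  rintro (y | y | _ | _)
  exacts [⟨.inl y, rfl⟩, ⟨.inr (.inl y), rfl⟩, ⟨.inr (.inr true), rfl⟩, ⟨.inr (.inr false), rfl⟩]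

/-- The rules of a complete presentation of `N`. They push the idempotent through the free group
letters, cancel inverse letters, and sort the letters `c y`. -/
inductive ExtRel : FreeMonoid ExtGen → FreeMonoid ExtGen → Prop
  | g_inv (x s : Bool) : ExtRel (of (g (x, s)) * of (g (x, !s))) 1
  | g_h (y : Bool × Bool) : ExtRel (of (g y) * of h) (of (c y))
  | h_g (y : Bool × Bool) : ExtRel (of h * of (g y)) (of (c y))
  | g_c (x y : Bool × Bool) : ExtRel (of (g x) * of (c y)) (of (c x) * of (c y))
  | c_g (x y : Bool × Bool) : ExtRel (of (c x) * of (g y)) (of (c x) * of (c y))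
  | h_h : ExtRel (of h * of h) (of h)
  | h_c (y : Bool × Bool) : ExtRel (of h * of (c y)) (of (c y))
  | c_h (y : Bool × Bool) : ExtRel (of (c y) * of h) (of (c y))
  | c_inv (x s : Bool) : ExtRel (of (c (x, s)) * of (c (x, !s))) (of h)
  | swap (s t : Bool) :
      ExtRel (of (c (true, s)) * of (c (false, t))) (of (c (false, t)) * of (c (true, s)))
  | z_mul (x : ExtGen) : ExtRel (of z * of x) (of z)
  | mul_z (x : ExtGen) : ExtRel (of x * of z) (of z)

theorem finiteRules_extRel : FiniteRules ExtRel := by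
  have short_finite : {w : FreeMonoid ExtGen | w.length ≤ 2}.Finite :=
    List.finite_length_le ExtGen 2
  refine (short_finite.prod short_finite).subset ?_
  rintro ⟨u, v⟩ huv
  cases huv <;> exact ⟨Nat.le_of_ble_eq_true rfl, Nat.le_of_ble_eq_true rfl⟩

/-- An interpretation of the letters by increasing functions for which every rule decreases the
weight. The letters `g y` weigh more than the corresponding `c y`, and the rule `swap` decreases the
weight because adding before doubling exceeds doubling before adding. -/
def ExtGen.act : ExtGen → ℕ → ℕ
  | g _, n => 2 * n + 1
  | c (false, _), n => 2 * n
  | c (true, _), n => n + 1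
  | h, n => n + 1
  | z, n => n + 1

theorem ExtGen.act_strictMono (x : ExtGen) : StrictMono x.act := by
  intro m n hmn
  rcases x with _ | ⟨_ | _, _⟩ | _ | _ <;> simp only [ExtGen.act] <;> omega

theorem ExtRel.weight_lt {u v : FreeMonoid ExtGen} (huv : ExtRel u v) {n : ℕ} (hn : n ≥ 1) :
    weight ExtGen.act v n < weight ExtGen.act u n := by
  have lt_act (x : ExtGen) {m : ℕ} (hm : 1 ≤ m) : m < x.act m := by
    rcases x with _ | ⟨_ | _, _⟩ | _ | _ <;> simp only [ExtGen.act] <;> omega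
  cases huv with
  | z_mul x => simpa using lt_act x (m := z.act n) (by simp [ExtGen.act])
  | mul_z x => simpa using act_strictMono z (lt_act x hn)
  | g_inv | c_inv x | swap | h_h =>
    first | cases x | skip
    all_goals simp only [weight_mul, weight_of, weight_one, ExtGen.act]; omega
  | g_h y | h_g y | h_c y | c_h y =>
    rcases y with ⟨_ | _, _⟩ <;> simp only [weight_mul, weight_of, ExtGen.act] <;> omega
  | g_c x y | c_g x y =>
    rcases x with ⟨_ | _, _⟩ <;> rcases y with ⟨_ | _, _⟩ <;>
      simp only [weight_mul, weight_of, ExtGen.act] <;> omega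

theorem isNoetherian_extRel : IsNoetherian ExtRel :=
  isNoetherian_of_weight_lt ExtGen.act_strictMono 1 fun _ _ hlr _ => hlr.weight_lt

/-- The element of the model of `N` represented by a letter. -/
def ExtGen.model : ExtGen → Model true
  | g y => .base (.mk [y])
  | c y => .mid (expSum (.mk [y]))
  | h => .mid 1
  | z => .zero

theorem mk_singleton_mul_mk_singleton_not (x s : Bool) :
    (FreeGroup.mk [(x, s)] * FreeGroup.mk [(x, !s)] : FreeGroup Bool) = 1 := by
  rw [FreeGroup.mul_mk, FreeGroup.one_eq_mk]
  exact Quot.sound FreeGroup.Red.Step.cons_not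

theorem ExtRel.lift_model_eq {u v : FreeMonoid ExtGen} (huv : ExtRel u v) :
    FreeMonoid.lift ExtGen.model u = FreeMonoid.lift ExtGen.model v := by
  cases huv with
  | g_inv x s => exact congrArg Layered.base (mk_singleton_mul_mk_singleton_not x s)
  | c_inv x s =>
    exact congrArg Layered.mid
      ((map_mul expSum _ _).symm.trans (by rw [mk_singleton_mul_mk_singleton_not, map_one]))
  | swap => simp [ExtGen.model, mul_comm]
  | _ => simp [ExtGen.model]

theorem closure_range_extGen_model : Submonoid.closure (Set.range ExtGen.model) = ⊤ := by
  rw [eq_top_iff, ← closure_range_model]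
  refine Submonoid.closure_mono ?_
  rintro _ ⟨_ | _ | _ | _ | _ | _, rfl⟩
  exacts [⟨g (false, true), rfl⟩, ⟨g (false, false), rfl⟩, ⟨g (true, true), rfl⟩,
    ⟨g (true, false), rfl⟩, ⟨h, rfl⟩, ⟨z, rfl⟩]

/-- Reduction by the rules of the complete presentation. -/
local infix:50 " ⟶* " => Reduces ExtRel

/-- The word in the letters `g y` given by a list, the normal form of an element of the free
group. -/
def gWord (L : List (Bool × Bool)) : FreeMonoid ExtGen := ofList (L.map g)

/-- The word in the letters `c y` given by a list. -/
def cWord (L : List (Bool × Bool)) : FreeMonoid ExtGen := ofList (L.map c)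

/-- The shortest word representing the product of `h` with the free group word `L`: the word in the
letters `c y` given by `L`, or `h` if `L` is empty. -/
def hWord : List (Bool × Bool) → FreeMonoid ExtGen
  | [] => of h
  | y :: L => of (c y) * cWord L

theorem gWord_cons (y : Bool × Bool) (L : List (Bool × Bool)) :
    gWord (y :: L) = of (g y) * gWord L := rfl

theorem cWord_cons (y : Bool × Bool) (L : List (Bool × Bool)) :
    cWord (y :: L) = of (c y) * cWord L := rfl

theorem gWord_append (L L' : List (Bool × Bool)) : gWord (L ++ L') = gWord L * gWord L' := by
  simp [gWord]

theorem cWord_append (L L' : List (Bool × Bool)) : cWord (L ++ L') = cWord L * cWord L' := by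
  simp [cWord]

theorem c_mul_hWord (y : Bool × Bool) (L : List (Bool × Bool)) :
    of (c y) * hWord L ⟶* hWord (y :: L) := by
  cases L with
  | nil => exact Reduces.of_rel (.c_h y)
  | cons x L => exact .refl

theorem g_mul_hWord (y : Bool × Bool) (L : List (Bool × Bool)) :
    of (g y) * hWord L ⟶* hWord (y :: L) := by
  cases L with
  | nil => exact Reduces.of_rel (.g_h y)
  | cons x L => exact Reduces.mul_right (.of_rel (ExtRel.g_c y x)) (cWord L)

theorem h_mul_hWord (L : List (Bool × Bool)) : of h * hWord L ⟶* hWord L := by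
  cases L with
  | nil => exact Reduces.of_rel .h_h
  | cons x L => exact Reduces.mul_right (.of_rel (ExtRel.h_c x)) (cWord L)

theorem h_mul_cWord (L : List (Bool × Bool)) : of h * cWord L ⟶* hWord L := by
  cases L with
  | nil => exact .refl
  | cons x L => exact Reduces.mul_right (.of_rel (ExtRel.h_c x)) (cWord L)

theorem cWord_mul_hWord (L L' : List (Bool × Bool)) : cWord L * hWord L' ⟶* hWord (L ++ L') := by
  induction L with
  | nil => exact .refl
  | cons y L ih => exact (Reduces.mul_left (of (c y)) ih).trans (c_mul_hWord y (L ++ L'))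

theorem hWord_cons_reduces (y : Bool × Bool) {L L' : List (Bool × Bool)} (hL : L ≠ [])
    (h : hWord L ⟶* hWord L') : hWord (y :: L) ⟶* hWord (y :: L') := by
  cases L with
  | nil => exact absurd rfl hL
  | cons x L => exact (Reduces.mul_left (of (c y)) h).trans (c_mul_hWord y L')

theorem gWord_reduces {L L' : List (Bool × Bool)} (h : FreeGroup.Red L L') :
    gWord L ⟶* gWord L' := by
  induction h with
  | refl => exact .refl
  | tail _ step ih =>
    refine ih.trans ?_
    obtain @⟨L₁, L₂, x, s⟩ := step
    rw [gWord_append, gWord_append, gWord_cons, gWord_cons, ← mul_assoc (of _)]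
    exact Reduces.mul_left _ (.mul_right (.of_rel (ExtRel.g_inv x s)) _)

theorem hWord_reduces {L L' : List (Bool × Bool)} (h : FreeGroup.Red L L') :
    hWord L ⟶* hWord L' := by
  induction h with
  | refl => exact .refl
  | tail _ step ih =>
    refine ih.trans ?_
    obtain @⟨L₁, L₂, x, s⟩ := step
    have split_word : hWord (L₁ ++ (x, s) :: (x, !s) :: L₂) =
        cWord L₁ * ((of (c (x, s)) * of (c (x, !s))) * cWord L₂) := by
      cases L₁ with
      | nil => rfl
      | cons y L₁ => simp only [hWord, List.cons_append, cWord_append, cWord_cons, mul_assoc]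
    rw [split_word]
    calc cWord L₁ * ((of (c (x, s)) * of (c (x, !s))) * cWord L₂)
      _ ⟶* cWord L₁ * (of h * cWord L₂) :=
        Reduces.mul_left _ (.mul_right (.of_rel (.c_inv x s)) _)
      _ ⟶* cWord L₁ * hWord L₂ := Reduces.mul_left _ (h_mul_cWord L₂)
      _ ⟶* hWord (L₁ ++ L₂) := cWord_mul_hWord L₁ L₂

theorem hWord_cons_append_reduces {L : List (Bool × Bool)} (hL : ∀ y ∈ L, y.1 = false) (s : Bool)
    (L' : List (Bool × Bool)) :
    hWord ((true, s) :: (L ++ L')) ⟶* hWord (L ++ (true, s) :: L') := by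
  induction L with
  | nil => exact .refl
  | cons y L ih =>
    obtain ⟨x, t⟩ := y
    obtain ⟨rfl, tail_false⟩ : x = false ∧ ∀ y ∈ L, y.1 = false := List.forall_mem_cons.1 hL
    calc hWord ((true, s) :: ((false, t) :: L ++ L'))
      _ ⟶* hWord ((false, t) :: (true, s) :: (L ++ L')) := by
        simpa only [hWord, List.cons_append, cWord_cons, mul_assoc]
          using Reduces.mul_right (.of_rel (ExtRel.swap s t)) (cWord (L ++ L'))
      _ ⟶* hWord ((false, t) :: (L ++ (true, s) :: L')) :=
        hWord_cons_reduces _ (List.cons_ne_nil _ _) (ih tail_false)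

theorem red_cons_toWord {X : Type*} [DecidableEq X] (y : X × Bool) (t : FreeGroup X) :
    FreeGroup.Red (y :: t.toWord) (FreeGroup.mk [y] * t).toWord := by
  have toWord_eq : (FreeGroup.mk [y] * t).toWord = FreeGroup.reduce (y :: t.toWord) := by
    conv_lhs => rw [← FreeGroup.mk_toWord (x := t), FreeGroup.mul_mk, FreeGroup.toWord_mk]
    rfl
  exact toWord_eq ▸ FreeGroup.reduce.red

theorem fst_eq_of_mem_toWord_of_zpow {X : Type*} [DecidableEq X] {x : X} {i : ℤ} {y : X × Bool}
    (hy : y ∈ (FreeGroup.of x ^ i).toWord) : y.1 = x := by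
  obtain ⟨n, rfl | rfl⟩ := i.eq_nat_or_neg
  · rw [zpow_natCast, FreeGroup.toWord_of_pow] at hy
    rw [List.eq_of_mem_replicate hy]
  · rw [zpow_neg, zpow_natCast, FreeGroup.toWord_inv, FreeGroup.toWord_of_pow] at hy
    simp only [FreeGroup.invRev, List.map_replicate, List.reverse_replicate] at hy
    rw [List.eq_of_mem_replicate hy]

/-- The reduced list `a ^ i b ^ j` of the free group letters representing `(i, j)`. -/
def abList (α : Multiplicative ℤ × Multiplicative ℤ) : List (Bool × Bool) :=
  (FreeGroup.of false ^ α.1.toAdd).toWord ++ (FreeGroup.of true ^ α.2.toAdd).toWord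

theorem mk_singleton_eq_zpow {X : Type*} (x : X) (s : Bool) :
    FreeGroup.mk [(x, s)] = FreeGroup.of x ^ (if s then 1 else -1 : ℤ) := by
  cases s
  · simp [FreeGroup.of, FreeGroup.inv_mk, FreeGroup.invRev]
  · simp [FreeGroup.of]

theorem hWord_cons_abList (y : Bool × Bool) (α : Multiplicative ℤ × Multiplicative ℤ) :
    hWord (y :: abList α) ⟶* hWord (abList (expSum (.mk [y]) * α)) := by
  obtain ⟨x, s⟩ := y
  have red (i : ℤ) : FreeGroup.Red ((x, s) :: (FreeGroup.of x ^ i).toWord)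
      (FreeGroup.of x ^ ((if s then 1 else -1) + i)).toWord := by
    rw [zpow_add, ← mk_singleton_eq_zpow]
    exact red_cons_toWord _ _
  rw [mk_singleton_eq_zpow, map_zpow, expSum_of]
  generalize (if s then 1 else -1 : ℤ) = i at red ⊢
  cases x with
  | false =>
    have red_left := (red α.1.toAdd).append_append
      (.refl (L := (FreeGroup.of true ^ α.2.toAdd).toWord))
    simpa [abList] using hWord_reduces red_left
  | true =>
    refine (hWord_cons_append_reduces (fun _ => fst_eq_of_mem_toWord_of_zpow) s _).trans ?_
    have red_right := FreeGroup.Red.append_append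
      (.refl (L := (FreeGroup.of false ^ α.1.toAdd).toWord)) (red α.2.toAdd)
    simpa [abList] using hWord_reduces red_right

theorem c_mul_gWord (y : Bool × Bool) (L : List (Bool × Bool)) :
    of (c y) * gWord L ⟶* hWord (abList (expSum (.mk (y :: L)))) := by
  induction L generalizing y with
  | nil => simpa [abList] using! hWord_cons_abList y 1
  | cons x L ih =>
    calc of (c y) * gWord (x :: L)
      _ ⟶* of (c y) * (of (c x) * gWord L) := by
        simpa only [gWord_cons, mul_assoc]
          using Reduces.mul_right (.of_rel (ExtRel.c_g y x)) (gWord L)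
      _ ⟶* of (c y) * hWord (abList (expSum (.mk (x :: L)))) := Reduces.mul_left _ (ih x)
      _ ⟶* hWord (y :: abList (expSum (.mk (x :: L)))) := c_mul_hWord _ _
      _ ⟶* hWord (abList (expSum (.mk [y]) * expSum (.mk (x :: L)))) := hWord_cons_abList _ _
      _ = hWord (abList (expSum (.mk (y :: x :: L)))) := by
        rw [← map_mul, FreeGroup.mul_mk, List.singleton_append]

theorem h_mul_gWord (L : List (Bool × Bool)) :
    of h * gWord L ⟶* hWord (abList (expSum (.mk L))) := by
  cases L with
  | nil => exact .refl
  | cons y L => exact (Reduces.mul_right (.of_rel (.h_g y)) (gWord L)).trans (c_mul_gWord y L)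

theorem z_mul_reduces (w : FreeMonoid ExtGen) : of z * w ⟶* of z := by
  induction w using FreeMonoid.inductionOn' with
  | one => exact .refl
  | of_mul x w ih =>
    rw [← mul_assoc]
    exact (Reduces.mul_right (.of_rel (.z_mul x)) w).trans ih

/-- The normal form of an element of the model of `N`. -/
def normalForm : Model true → FreeMonoid ExtGen
  | .base t => gWord t.toWord
  | .mid α => hWord (abList α)
  | .zero => of z

theorem of_mul_normalForm_base (x : ExtGen) (t : FreeGroup Bool) :
    of x * normalForm (.base t) ⟶* normalForm (x.model * .base t) := by
  cases x with
  | g y => exact gWord_reduces (red_cons_toWord y t)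
  | c y =>
    have reduces := c_mul_gWord y t.toWord
    rwa [← List.singleton_append, ← FreeGroup.mul_mk, FreeGroup.mk_toWord, map_mul] at reduces
  | h =>
    have reduces := h_mul_gWord t.toWord
    rwa [FreeGroup.mk_toWord, ← one_mul (expSum t)] at reduces
  | z => exact z_mul_reduces _

theorem of_mul_normalForm_mid (x : ExtGen) (α : Multiplicative ℤ × Multiplicative ℤ) :
    of x * normalForm (.mid α) ⟶* normalForm (x.model * .mid α) := by
  cases x with
  | g y => exact (g_mul_hWord _ _).trans (hWord_cons_abList y α)
  | c y => exact (c_mul_hWord _ _).trans (hWord_cons_abList y α)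
  | h =>
    rw [ExtGen.model, Layered.mid_mul_mid, if_pos rfl, one_mul]
    exact h_mul_hWord _
  | z => exact z_mul_reduces _

theorem of_mul_normalForm (x : ExtGen) (m : Model true) :
    of x * normalForm m ⟶* normalForm (x.model * m) := by
  cases m with
  | base t => exact of_mul_normalForm_base x t
  | mid α => exact of_mul_normalForm_mid x α
  | zero =>
    rw [Layered.mul_zero]
    exact Reduces.of_rel (.mul_z x)

theorem hasFiniteCompletePresentation_N : HasFiniteCompletePresentation (PresentedMonoid NRel) := by
  obtain ⟨e, -⟩ := exists_mulEquiv_N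
  exact (hasFiniteCompletePresentation_of_normalForm finiteRules_extRel isNoetherian_extRel
    closure_range_extGen_model (fun _ _ => ExtRel.lift_model_eq) .refl
    of_mul_normalForm).of_mulEquiv e

end CompletePresentations

end MonoidRewriting

theorem mainTheorem3 :
    MonoidRewriting.Isometric
        (MonoidRewriting.cayleySemimetric (PresentedMonoid.of MonoidRewriting.MRel))
        (MonoidRewriting.cayleySemimetric (PresentedMonoid.of MonoidRewriting.NRel)) ∧
      ¬ MonoidRewriting.HasFDT (PresentedMonoid MonoidRewriting.MRel) ∧
      ¬ MonoidRewriting.HasFiniteCompletePresentation (PresentedMonoid MonoidRewriting.MRel) ∧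
      MonoidRewriting.HasFiniteCompletePresentation (PresentedMonoid MonoidRewriting.NRel) ∧
      MonoidRewriting.HasFDT (PresentedMonoid MonoidRewriting.NRel) ∧
      ¬ MonoidRewriting.IsIsometryInvariant (fun S _ => MonoidRewriting.HasFDT S) ∧
      ¬ MonoidRewriting.IsIsometryInvariant
          (fun S _ => MonoidRewriting.HasFiniteCompletePresentation S) := by
  have iso := MonoidRewriting.isometric_M_N
  have not_fdt_M := MonoidRewriting.not_hasFDT_M
  have not_complete_M : ¬ MonoidRewriting.HasFiniteCompletePresentation
      (PresentedMonoid MonoidRewriting.MRel) := fun h => not_fdt_M h.hasFDT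
  have complete_N := MonoidRewriting.hasFiniteCompletePresentation_N
  have fdt_N := complete_N.hasFDT
  have gens (rels) : Submonoid.closure
      (Set.range (PresentedMonoid.of (α := MonoidRewriting.Gen) rels)) = ⊤ :=
    PresentedMonoid.closure_range_of rels
  exact ⟨iso, not_fdt_M, not_complete_M, complete_N, fdt_N,
    fun h => not_fdt_M ((h _ _ _ _ _ _ (gens _) (gens _) iso).2 fdt_N),
    fun h => not_complete_M ((h _ _ _ _ _ _ (gens _) (gens _) iso).2 complete_N)⟩
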